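/- **Setting.** Let $p\ge 1$, $k\ge 2$, and let $z_t=(y_t,x_t^{\mathsf T})^{\mathsf T}\in\mathbb R\times\mathbb R^{p-1}$ satisfy, for $t\ge 1$, $$z_t=c+\sum_{i=1}^k\big(\phi_i^+y_{t-i}^+ +\phi_i^-y_{t-i}^-+\Phi_i^x x_{t-i}\big)+u_t,\qquad y_t^+=\max\{y_t,0\},\quad y_t^-=\min\{y_t,0\},$$ with $\phi_i^\pm\in\mathbb R^p$, $\Phi_i^x\in\mathbb R^{p\times(p-1)}$ and random initial values $z_{-k+1},\dots,z_0$, which may depend on the sample size $n$ (a model with $k=1$ is treated as one with $k=2$ and $\phi_2^\pm=0$, $\Phi_2^x=0$). Put $\Phi_i^\pm=[\phi_i^\pm,\Phi_i^x]$, $\Phi^\pm(\lambda)=I_p-\sum_{i=1}^k\Phi_i^\pm\lambda^i$, $\Pi^\pm=-\Phi^\pm(1)=[\pi^\pm,\Pi^x]$, $\Gamma_i^\pm=-\sum_{j=i+1}^k\Phi_j^\pm$ and $\Gamma^\pm(1)=I_p-\sum_{i=1}^{k-1}\Gamma_i^\pm$. Let $D[0,1]$ be the space of cadlag functions on $[0,1]$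 with the uniform topology, and $\Delta z_t=z_t-z_{t-1}$. A sequence $w_t$ (possibly depending on $n$) is $I^*(0)$ if $n^{-1/2}\max_{1\le t\le n}\|w_t\|\to 0$ in probability as $n\to\infty$. **Assumptions.** 1. (Errors.) For some $\delta_u>0$, $\sup_{t\ge 1}\mathbb E\|u_t\|^{2+\delta_u}<\infty$, and $n^{-1/2}\sum_{t=1}^{\lfloor n\lambda\rfloor}u_t$ converges weakly on $D[0,1]$ to a $p$-dimensional Brownian motion $U(\lambda)$ with positive definite variance $\Sigma$. 2. (Unit roots.) $\det\Phi^\pm(\lambda)$ has $q^\pm$ roots at $1$ (with multiplicity) and all its other complex roots outside the closed unit disc; $\operatorname{rank}\Pi^\pm=p-q^\pm$; and $c$ lies in the column spaces of $\Pi^+$ and of $\Pi^-$. 3. (Ranks.) $\operatorname{rank}\Pi^+=\operatorname{rank}\Pi^x=r$ and $\operatorname{rank}\Pi^-=r+1$. Write $\Pi^+=\alpha^+\beta^{+\mathsf T}$ with $\alpha^+,\beta^+\in\mathbb R^{p\times r}$ of rank $r$; let $\alpha^+_\perp,\beta^+_\perp\in\mathbb R^{p\times(p-r)}$ have rank $p-r$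 and satisfy $\alpha_\perp^{+\mathsf T}\alpha^+=0$, $\beta_\perp^{+\mathsf T}\beta^+=0$; and put $P_{\beta_\perp^+}=\beta_\perp^+[\alpha_\perp^{+\mathsf T}\Gamma^+(1)\beta_\perp^+]^{-1}\alpha_\perp^{+\mathsf T}$. 4. (Joint spectral radius.) $\rho_{\mathrm{JSR}}(\{F_0,F_1\})<1$, where $\rho_{\mathrm{JSR}}(\mathcal A)=\limsup_{t\to\infty}\sup\{\rho(B)^{1/t}: B \text{ a product of } t \text{ elements of }\mathcal A\}$, with $\rho$ the spectral radius, and $$F_\delta=\begin{bmatrix}I+\boldsymbol\beta^{\mathsf T}\boldsymbol\alpha & \boldsymbol\beta_{1:p}^{\mathsf T}(\phi_1^--\phi_1^+)\delta & \boldsymbol\beta_{1:p}^{\mathsf T}(\varphi^--\varphi^+)\\ e_1^{\mathsf T}\boldsymbol\alpha & [1+e_1^{\mathsf T}(\phi_1^--\phi_1^+)]\delta & e_1^{\mathsf T}(\varphi^--\varphi^+)\\ 0&\delta&0\\ 0&0&[I_{k-2},0]\end{bmatrix},\qquad \varphi^\pm=[\phi_2^\pm,\dots,\phi_k^\pm].$$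 Here $\boldsymbol\alpha,\boldsymbol\beta\in\mathbb R^{kp\times[r+p(k-1)]}$: the first block row of $\boldsymbol\alpha$ is $[\alpha^+,\Gamma_1^+,\dots,\Gamma_{k-1}^+]$ and its other rows are $[0_{p(k-1)\times r},I_{p(k-1)}]$; the first block row of $\boldsymbol\beta^{\mathsf T}$ is $[\beta^{+\mathsf T},0,\dots,0]$ and its $(m+1)$-th block row, $1\le m\le k-1$, has $I_p$ in block column $m$, $-I_p$ in block column $m+1$ and zeros elsewhere; $\boldsymbol\beta_{1:p}$ denotes the first $p$ rows of $\boldsymbol\beta$. 5. $\kappa_1<0$, where $\kappa_1$ is the first element of $\kappa=P_{\beta^+_\perp}\pi^-$. 6. (Initial values.) $\beta^{+\mathsf T}z_t$ and $y_t^-$ for $-k+1\le t\le 0$, and $\Delta z_t$ for $-k+2\le t\le 0$, have uniformly bounded moments of order $2+\delta_u$; and $n^{-1/2}z_0\to\mathcal Z_0=(\mathcal Y_0,\mathcal X_0)$ in probability, where $\mathcal Z_0$ is non-random and $\pi^+[\mathcal Y_0]_++\pi^-[\mathcal Y_0]_-+\Pi^x\mathcal X_0=0$, with $[a]_+=\max\{a,0\}$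 and $[a]_-=\min\{a,0\}$. **Theorem.** Let $U_0(\lambda)=\Gamma^+(1)\mathcal Z_0+U(\lambda)$. Then: (i) $\beta^{+\mathsf T}z_t$, $\Delta z_t$ and $y_t^-$ are all $I^*(0)$; (ii) on $D[0,1]$, $$n^{-1/2}\begin{bmatrix}y_{\lfloor n\lambda\rfloor}\\x_{\lfloor n\lambda\rfloor}\end{bmatrix}\Rightarrow\begin{bmatrix}Y(\lambda)\\X(\lambda)\end{bmatrix}=P_{\beta_\perp^+}U_0(\lambda)+\kappa_1^{-1}\kappa\sup_{\lambda'\le\lambda}\big[-e_1^{\mathsf T}P_{\beta_\perp^+}U_0(\lambda')\big]_+ .$$ In particular $Y(\lambda)=e_1^{\mathsf T}P_{\beta_\perp^+}U_0(\lambda)+\sup_{\lambda'\le\lambda}[-e_1^{\mathsf T}P_{\beta_\perp^+}U_0(\lambda')]_+$, which is a Brownian motion (of nonzero variance, initialised at $\mathcal Y_0\ge 0$) regulated from below at zero. -/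

import Mathlib

open MeasureTheory ProbabilityTheory Filter Topology
open scoped NNReal ENNReal unitInterval Matrix

namespace RegCoint

noncomputable section

/-! ### The space `D[0,1]` and weak convergence of processes -/

/-- A function on `[0,1]` is cadlag: right-continuous, with left limits. -/
def IsCadlag {E : Type*} [TopologicalSpace E] (f : I → E) : Prop :=
  ∀ t : I, ContinuousWithinAt f (Set.Ici t) t ∧ ∃ l, Tendsto f (𝓝[<] t) (𝓝 l)

/-- The space of cadlag functions `[0,1] → E`. -/
def CadlagSpace (E : Type*) [EMetricSpace E] : Type _ :=
  {f : UniformFun I E // IsCadlag (UniformFun.toFun f)}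

/-- The uniform topology on the cadlag functions, given by the distance
`sup_t edist (f t) (g t)`. -/
instance (E : Type*) [EMetricSpace E] : EMetricSpace (CadlagSpace E) :=
  inferInstanceAs (EMetricSpace {f : UniformFun I E // IsCadlag (UniformFun.toFun f)})

instance (E : Type*) [EMetricSpace E] : MeasurableSpace (CadlagSpace E) := borel _

instance (E : Type*) [EMetricSpace E] : BorelSpace (CadlagSpace E) := ⟨rfl⟩

/-- The value of a cadlag function at a time. -/
def CadlagSpace.path {E : Type*} [EMetricSpace E] (f : CadlagSpace E) : I → E :=
  UniformFun.toFun f.1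

/-- Weak convergence on `D[0,1]` (uniform topology) of the processes `X n` to the process `Z`:
their paths are almost surely those of random elements of `D[0,1]` whose laws converge weakly. -/
def ConvergesWeaklyOnD {Ω Ω' E : Type*} [MeasurableSpace Ω] [MeasurableSpace Ω'] [EMetricSpace E]
    (P : Measure Ω) [IsProbabilityMeasure P] (P' : Measure Ω') [IsProbabilityMeasure P']
    (X : ℕ → I → Ω → E) (Z : I → Ω' → E) : Prop :=
  ∃ (X' : ℕ → Ω → CadlagSpace E) (Z' : Ω' → CadlagSpace E),
    (∀ n, ∀ᵐ ω ∂P, ∀ t, (X' n ω).path t = X n t ω) ∧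
    (∀ᵐ ω ∂P', ∀ t, (Z' ω).path t = Z t ω) ∧
    TendstoInDistribution X' atTop Z' (fun _ => P) P'

/-! ### Brownian motions on `[0,1]` -/

/-- `W` is a Brownian motion on `[0,1]` in `ℝ^ι`, started at `0`, with variance matrix `S`. -/
structure IsBrownianMotion {Ω ι : Type*} [MeasurableSpace Ω] [Fintype ι] [DecidableEq ι]
    (W : I → Ω → EuclideanSpace ℝ ι) (S : Matrix ι ι ℝ) (P : Measure Ω) : Prop where
  start : ∀ᵐ ω ∂P, W 0 ω = 0
  indep : HasIndepIncrements W P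
  law : ∀ s t : I, s ≤ t →
    HasLaw (fun ω => W t ω - W s ω) (multivariateGaussian 0 (((t : ℝ) - s) • S)) P
  cont : ∀ᵐ ω ∂P, Continuous (fun t => W t ω)

/-- `W` is a scalar Brownian motion on `[0,1]`, started at `w₀`, with variance `v`. -/
structure IsScalarBrownianMotion {Ω : Type*} [MeasurableSpace Ω]
    (W : I → Ω → ℝ) (w₀ : ℝ) (v : ℝ≥0) (P : Measure Ω) : Prop where
  start : ∀ᵐ ω ∂P, W 0 ω = w₀
  indep : HasIndepIncrements W P
  law : ∀ s t : I, s ≤ t →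
    HasLaw (fun ω => W t ω - W s ω) (gaussianReal 0 (((t : ℝ) - s).toNNReal * v)) P
  cont : ∀ᵐ ω ∂P, Continuous (fun t => W t ω)

/-- The regulator `sup_{s ≤ t} [-w s]₊` of a path `w`. -/
def regulator (w : I → ℝ) (t : I) : ℝ := ⨆ s : Set.Iic t, max (-w s) 0

/-- `V` is a Brownian motion regulated from below at zero, started at `w₀ ≥ 0`, with nonzero
variance. -/
def IsRegulatedBrownianMotion {Ω : Type*} [MeasurableSpace Ω]
    (V : I → Ω → ℝ) (w₀ : ℝ) (P : Measure Ω) : Prop :=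
  0 ≤ w₀ ∧ ∃ (W : I → Ω → ℝ) (v : ℝ≥0), 0 < v ∧ IsScalarBrownianMotion W w₀ v P ∧
    ∀ᵐ ω ∂P, ∀ t, V t ω = W t ω + regulator (fun s => W s ω) t

/-! ### Bounded moments and `I*(0)` -/

/-- The random vectors `f i`, `i ∈ s`, have uniformly bounded moments of order `m`. -/
def BoundedMoments {Ω ι E : Type*} [MeasurableSpace Ω] [NormedAddCommGroup E]
    (f : ι → Ω → E) (s : Set ι) (m : ℝ) (P : Measure Ω) : Prop :=
  (∀ i ∈ s, AEStronglyMeasurable (f i) P) ∧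
    ∃ C : ℝ≥0, ∀ i ∈ s, eLpNorm (f i) (ENNReal.ofReal m) P ≤ C

/-- `w ∼ I*(0)`: `max_{1 ≤ t ≤ n} ‖w t‖ = o_p(n^{1/2})`. The sequence is allowed to depend on the
sample size `n`; the case of a single sequence is that of a constant dependence. -/
def IsStarStationary {Ω E : Type*} [MeasurableSpace Ω] [NormedAddCommGroup E]
    (w : ℕ → ℕ → Ω → E) (P : Measure Ω) : Prop :=
  TendstoInMeasure P
    (fun (n : ℕ) ω => (√(n : ℝ))⁻¹ * (((Finset.Icc 1 n).sup fun t => ‖w n t ω‖₊ : ℝ≥0) : ℝ))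
    atTop (fun _ => (0 : ℝ))

/-! ### Matrices -/

/-- A matrix acting on Euclidean vectors. -/
def act {m n : Type*} [Fintype n] (A : Matrix m n ℝ) (v : EuclideanSpace ℝ n) :
    EuclideanSpace ℝ m :=
  WithLp.toLp 2 (A *ᵥ v.ofLp)

/-- The matrix `[v, A]` with first column `v` followed by the columns of `A`. -/
def colCons {m : Type*} {d : ℕ} (v : m → ℝ) (A : Matrix m (Fin d) ℝ) :
    Matrix m (Fin (d + 1)) ℝ :=
  Matrix.of fun a => Fin.cons (v a) (A a)

/-- `B` is an orthocomplement of the full column rank matrix `A`. -/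
def IsOrthocomplement {m n q : ℕ} (A : Matrix (Fin m) (Fin n) ℝ) (B : Matrix (Fin m) (Fin q) ℝ) :
    Prop :=
  n + q = m ∧ B.rank = q ∧ Bᵀ * A = 0

/-- The joint spectral radius `limsup_t sup {ρ(B)^{1/t} : B a t-fold product from S}`, where `ρ` is
the spectral radius (over the complex numbers). -/
def jointSpectralRadius {N : Type*} [Fintype N] [DecidableEq N] (S : Set (Matrix N N ℝ)) : ℝ≥0∞ :=
  limsup (fun t : ℕ => ⨆ L ∈ {L : List (Matrix N N ℝ) | L.length = t ∧ ∀ A ∈ L, A ∈ S},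
    (spectralRadius ℂ (L.prod.map (algebraMap ℝ ℂ))) ^ (1 / (t : ℝ))) atTop

/-! ### The canonical CKSVAR -/

/-- The two regimes of the model. -/
inductive Regime
  | pos
  | neg

/-- The coefficients of a canonical CKSVAR for `z = (y, x) ∈ ℝ^p` with `p = d + 1` variables and
`k = l + 2` lags. Only the coefficients with index `1, …, k` play a role. -/
structure CKSVAR (d l : ℕ) where
  c : Fin (d + 1) → ℝ
  phi : Regime → ℕ → Fin (d + 1) → ℝ
  PhiX : ℕ → Matrix (Fin (d + 1)) (Fin d) ℝ

namespace CKSVAR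

variable {d l : ℕ} (M : CKSVAR d l)

/-- `Φᵢ^± = [φᵢ^±, Φᵢ^x]`. -/
def Phi (s : Regime) (i : ℕ) : Matrix (Fin (d + 1)) (Fin (d + 1)) ℝ :=
  colCons (M.phi s i) (M.PhiX i)

/-- The matrix polynomial `Φ^±(λ) = I - ∑_{i=1}^k Φᵢ^± λ^i`. -/
def arPoly (s : Regime) : Matrix (Fin (d + 1)) (Fin (d + 1)) (Polynomial ℝ) :=
  1 - ∑ i ∈ Finset.Icc 1 (l + 2), (Polynomial.X ^ i : Polynomial ℝ) • (M.Phi s i).map Polynomial.C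

/-- `π^± = -φ^±(1)`, where `φ₀^± = e₁`. -/
def pi (s : Regime) : Fin (d + 1) → ℝ :=
  -(Pi.single 0 1 - ∑ i ∈ Finset.Icc 1 (l + 2), M.phi s i)

/-- `Π^x = -Φ^x(1)`, where `Φ₀^x` consists of the last `p - 1` columns of the identity. -/
def PiX : Matrix (Fin (d + 1)) (Fin d) ℝ :=
  -((1 : Matrix (Fin (d + 1)) (Fin (d + 1)) ℝ).submatrix id Fin.succ
    - ∑ i ∈ Finset.Icc 1 (l + 2), M.PhiX i)

/-- `Π^± = [π^±, Π^x]`. -/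
def PiMat (s : Regime) : Matrix (Fin (d + 1)) (Fin (d + 1)) ℝ :=
  colCons (M.pi s) M.PiX

/-- `Γᵢ^± = -∑_{j=i+1}^k Φⱼ^±`. -/
def Gamma (s : Regime) (i : ℕ) : Matrix (Fin (d + 1)) (Fin (d + 1)) ℝ :=
  -∑ j ∈ Finset.Icc (i + 1) (l + 2), M.Phi s j

/-- `Γ^±(1) = I - ∑_{i=1}^{k-1} Γᵢ^±`. -/
def GammaOne (s : Regime) : Matrix (Fin (d + 1)) (Fin (d + 1)) ℝ :=
  1 - ∑ i ∈ Finset.Icc 1 (l + 1), M.Gamma s i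

/-- The space of common trends `{(y, x) : π⁺[y]₊ + π⁻[y]₋ + Π^x x = 0}`. -/
def commonTrends : Set (EuclideanSpace ℝ (Fin (d + 1))) :=
  {z | max (z 0) 0 • M.pi .pos + min (z 0) 0 • M.pi .neg + M.PiX *ᵥ (fun j => z j.succ) = 0}

/-- `z` satisfies the equations of the model at the times `t ≥ 1`, with errors `u` and initial
values `z t`, `-k + 1 ≤ t ≤ 0`. -/
def IsGenerated {Ω : Type*} (u : ℕ → Ω → EuclideanSpace ℝ (Fin (d + 1)))
    (z : ℤ → Ω → EuclideanSpace ℝ (Fin (d + 1))) : Prop :=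
  ∀ t : ℕ, 1 ≤ t → ∀ ω, z t ω = WithLp.toLp 2 (M.c +
    ∑ i ∈ Finset.Icc 1 (l + 2),
      (max (z (t - i) ω 0) 0 • M.phi .pos i + min (z (t - i) ω 0) 0 • M.phi .neg i
        + M.PhiX i *ᵥ (fun j => z (t - i) ω j.succ))) + u t ω

/-- Unit roots: `det Φ^±(λ)` has `q^±` roots at unity and all others outside the unit circle,
`rank Π^± = r^± = p - q^±`, and `c` lies in the column spaces of `Π⁺` and `Π⁻`. -/
structure HasUnitRoots (q r : Regime → ℕ) : Prop where
  roots_one : ∀ s, (M.arPoly s).det.rootMultiplicity 1 = q s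
  roots_other : ∀ s, ∀ x : ℂ, Polynomial.aeval x (M.arPoly s).det = 0 → x = 1 ∨ 1 < ‖x‖
  rank_eq : ∀ s, (M.PiMat s).rank = r s
  rank_add : ∀ s, r s + q s = d + 1
  intercept : ∀ s, ∃ v, M.PiMat s *ᵥ v = M.c

/-! ### The companion matrices of the short-memory components -/

section Companion

variable {r : ℕ} (α β : Matrix (Fin (d + 1)) (Fin r) ℝ)

/-- The `kp × (r + p(k-1))` matrix with first block row `[α, Γ₁⁺, …, Γ_{k-1}⁺]` and further block
rows `[0, I, 0, …], …, [0, …, 0, I]`. -/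
def boldAlpha :
    Matrix (Fin (l + 2) × Fin (d + 1)) (Fin r ⊕ Fin (l + 1) × Fin (d + 1)) ℝ :=
  Matrix.of fun ja => Sum.elim
    (fun b => if ja.1 = 0 then α ja.2 b else 0)
    (fun mb => if ja.1 = 0 then M.Gamma .pos (mb.1 + 1) ja.2 mb.2
      else if ja.1 = mb.1.succ then (1 : Matrix (Fin (d + 1)) (Fin (d + 1)) ℝ) ja.2 mb.2 else 0)

/-- The `(r + p(k-1)) × kp` matrix with first block row `[βᵀ, 0, …, 0]` and further block rows
`[I, -I, 0, …], …, [0, …, 0, I, -I]`. -/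
def boldBetaT :
    Matrix (Fin r ⊕ Fin (l + 1) × Fin (d + 1)) (Fin (l + 2) × Fin (d + 1)) ℝ :=
  Matrix.of (Sum.elim
    (fun b ja => if ja.1 = 0 then β ja.2 b else 0)
    (fun mb ja => if ja.1 = mb.1.castSucc then
        (1 : Matrix (Fin (d + 1)) (Fin (d + 1)) ℝ) mb.2 ja.2
      else if ja.1 = mb.1.succ then -(1 : Matrix (Fin (d + 1)) (Fin (d + 1)) ℝ) mb.2 ja.2 else 0))

/-- The first `p` columns of `boldBetaT`. -/
def boldBetaTopT : Matrix (Fin r ⊕ Fin (l + 1) × Fin (d + 1)) (Fin (d + 1)) ℝ :=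
  (boldBetaT (l := l) β).submatrix id (fun a => ((0 : Fin (l + 2)), a))

/-- The difference `φᵢ⁻ - φᵢ⁺`. -/
def phiDiff (i : ℕ) : Fin (d + 1) → ℝ := M.phi .neg i - M.phi .pos i

/-- The matrix `F_δ`. Its index set consists of the `r + p(k-1)` equilibrium errors and
differences, of one auxiliary index, and of `k - 1` further indices. -/
def F (δ : ℝ) :
    Matrix ((Fin r ⊕ Fin (l + 1) × Fin (d + 1)) ⊕ (Unit ⊕ Fin (l + 1)))
      ((Fin r ⊕ Fin (l + 1) × Fin (d + 1)) ⊕ (Unit ⊕ Fin (l + 1))) ℝ :=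
  Matrix.fromBlocks
    (1 + boldBetaT (l := l) β * M.boldAlpha α)
    (Matrix.of fun a => Sum.elim
      (fun _ => (boldBetaTopT (l := l) β *ᵥ M.phiDiff 1) a * δ)
      (fun i : Fin (l + 1) => (boldBetaTopT (l := l) β *ᵥ M.phiDiff (i + 2)) a))
    (Matrix.of (Sum.elim (fun _ => M.boldAlpha α (0, 0)) (fun _ => 0)))
    (Matrix.fromBlocks
      (Matrix.of fun _ _ => (1 + M.phiDiff 1 0) * δ)
      (Matrix.of fun _ i => M.phiDiff ((i : ℕ) + 2) 0)
      (Matrix.of fun i _ => if i = 0 then δ else 0)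
      (Matrix.of fun i j => if (i : ℕ) = j + 1 then 1 else 0))

end Companion

/-! ### The limit process -/

section Limit

variable {q : ℕ} (αp βp : Matrix (Fin (d + 1)) (Fin q) ℝ)

/-- `P_{β⊥} = β⊥ [α⊥ᵀ Γ⁺(1) β⊥]⁻¹ α⊥ᵀ`. -/
def proj : Matrix (Fin (d + 1)) (Fin (d + 1)) ℝ :=
  βp * (αpᵀ * M.GammaOne .pos * βp)⁻¹ * αpᵀ

/-- `κ = P_{β⊥} π⁻`. -/
def kappa : Fin (d + 1) → ℝ := M.proj αp βp *ᵥ M.pi .neg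

variable {Ω' : Type*} (Z₀ : EuclideanSpace ℝ (Fin (d + 1)))
  (U : I → Ω' → EuclideanSpace ℝ (Fin (d + 1)))

/-- `P_{β⊥} U₀`, where `U₀ = Γ⁺(1) Z₀ + U`. -/
def projU (t : I) (ω : Ω') : EuclideanSpace ℝ (Fin (d + 1)) :=
  act (M.proj αp βp) (act (M.GammaOne .pos) Z₀ + U t ω)

/-- `P_{β⊥} U₀(t) + κ₁⁻¹ κ sup_{s ≤ t} [-e₁ᵀ P_{β⊥} U₀(s)]₊`. -/
def limitPath (t : I) (ω : Ω') : EuclideanSpace ℝ (Fin (d + 1)) :=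
  M.projU αp βp Z₀ U t ω +
    ((M.kappa αp βp 0)⁻¹ * regulator (fun s => M.projU αp βp Z₀ U s ω 0) t) •
      WithLp.toLp 2 (M.kappa αp βp)

end Limit

end CKSVAR

/-! ### Conditions on the errors and on the initial values -/

/-- The errors `u t`, `t ≥ 1`, have uniformly bounded moments of order `2 + δ`, and their partial
sums converge weakly to a Brownian motion `U` with positive definite variance `S`. -/
structure ErrorCondition {Ω Ω' : Type*} [MeasurableSpace Ω] [MeasurableSpace Ω'] {d : ℕ}
    (P : Measure Ω) [IsProbabilityMeasure P] (P' : Measure Ω') [IsProbabilityMeasure P']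
    (u : ℕ → Ω → EuclideanSpace ℝ (Fin (d + 1))) (δ : ℝ)
    (U : I → Ω' → EuclideanSpace ℝ (Fin (d + 1))) (S : Matrix (Fin (d + 1)) (Fin (d + 1)) ℝ) :
    Prop where
  delta_pos : 0 < δ
  moments : BoundedMoments u {t | 1 ≤ t} (2 + δ) P
  posDef : S.PosDef
  brownian : IsBrownianMotion U S P'
  partialSums : ConvergesWeaklyOnD P P'
    (fun (n : ℕ) t ω => (√(n : ℝ))⁻¹ • ∑ i ∈ Finset.Icc 1 ⌊n * (t : ℝ)⌋₊, u i ω) U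

/-- The conditions on the initial values `z n t`, `-k + 1 ≤ t ≤ 0`, `k = l + 2`, which may depend on
the sample size `n`. The differences `Δz_t` are those between initial values, `-k + 2 ≤ t ≤ 0`. -/
structure InitialCondition {Ω : Type*} [MeasurableSpace Ω] {d l r : ℕ} (M : CKSVAR d l)
    (P : Measure Ω) (β : Matrix (Fin (d + 1)) (Fin r) ℝ) (δ : ℝ)
    (z : ℕ → ℤ → Ω → EuclideanSpace ℝ (Fin (d + 1)))
    (Z₀ : EuclideanSpace ℝ (Fin (d + 1))) : Prop where
  measurable : ∀ n, ∀ t : ℤ, -(l + 1 : ℤ) ≤ t → t ≤ 0 → AEMeasurable (z n t) P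
  moments_eqErr : BoundedMoments (fun (i : ℕ × ℤ) ω => act βᵀ (z i.1 i.2 ω))
    {i | -(l + 1 : ℤ) ≤ i.2 ∧ i.2 ≤ 0} (2 + δ) P
  moments_neg : BoundedMoments (fun (i : ℕ × ℤ) ω => min (z i.1 i.2 ω 0) 0)
    {i | -(l + 1 : ℤ) ≤ i.2 ∧ i.2 ≤ 0} (2 + δ) P
  moments_diff : BoundedMoments (fun (i : ℕ × ℤ) ω => z i.1 i.2 ω - z i.1 (i.2 - 1) ω)
    {i | -(l : ℤ) ≤ i.2 ∧ i.2 ≤ 0} (2 + δ) P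
  tendsto : TendstoInMeasure P (fun (n : ℕ) ω => (√(n : ℝ))⁻¹ • z n 0 ω) atTop (fun _ => Z₀)
  mem : Z₀ ∈ M.commonTrends

end

end RegCoint

/-!
In error-correction form the short-memory components `βᵀz`, `Δz`, `y⁻` follow a linear recursion
driven by the shocks, whose matrix at time `t` is a convex combination of `F 0` and `F 1`: the
weight is the fraction which `y_t⁻` takes of the gap `y_t - y_{t-1}⁺`. A joint spectral radius
below `1` provides a norm which both matrices contract (Berger–Wang). It is built as an orbit
supremum when the matrices have no common invariant subspace, since then all entries of their
products are controlled by eigenvalues, and is glued from a subspace and its quotient otherwise.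
Hence the short-memory components are bounded by the largest of the shocks and initial values,
which is `o_p(√n)` by the moment conditions.

Multiplication by `P_{β⊥}` turns the model into `z_t = trend_t + κ ∑_{s ≤ t} y_s⁻ + o_p(√n)`. Its
first coordinate is an approximate discrete Skorokhod problem: `κ₁ ∑ y_s⁻` is increasing and grows
only while `y` is near zero, so that it is, up to `o_p(√n)`, the regulator of the trend. Thus the
rescaled process is close to the image of the rescaled partial sums of the shocks under the
regulator map, which is Lipschitz for the uniform norm, and the continuous mapping theorem applies.
-/

namespace RegCoint

noncomputable section

/-! ### Contracting norms and the Berger–Wang theorem -/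

section BergerWang

/-- Burnside's theorem, as the density theorem for a simple module with scalar commutant. -/
theorem subalgebra_eq_top_of_irreducible {K V : Type*} [Field K] [IsAlgClosed K] [AddCommGroup V]
    [Module K V] [FiniteDimensional K V] [Nontrivial V] (A : Subalgebra K (Module.End K V))
    (hA : ∀ W : Submodule K V, (∀ a ∈ A, W ≤ W.comap a) → W = ⊥ ∨ W = ⊤) : A = ⊤ := by
  have : IsSimpleModule A V := isSimpleModule_iff _ _ |>.2
    { eq_bot_or_eq_top := fun W => by
        simpa using hA (W.restrictScalars K) fun a ha w hw => W.smul_mem (⟨a, ha⟩ : A) hw }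
  have scalar (φ : Module.End A V) : ∃ c : K, ∀ v, φ v = c • v := by
    obtain ⟨c, rfl⟩ := (IsSimpleModule.algebraMap_end_bijective_of_isAlgClosed K (A := A)).2 φ
    exact ⟨c, fun v => Module.algebraMap_end_apply K A V c v⟩
  refine eq_top_iff.2 fun g _ => ?_
  let g' : Module.End (Module.End A V) V :=
    { g with
      map_smul' := fun φ v => by
        obtain ⟨c, hc⟩ := scalar φ
        simp [Module.End.smul_def, hc] }
  classical
  let b := Module.finBasis K V
  obtain ⟨a, ha⟩ := jacobson_density (R := A) g' (Finset.univ.image b)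
  have hga : g = a := b.ext fun i => ha (b i) (by simp)
  exact hga ▸ a.2

theorem norm_trace_le {K V : Type*} [NormedField K] [IsAlgClosed K] [AddCommGroup V] [Module K V]
    [FiniteDimensional K V] (g : Module.End K V) {c : ℝ} (hg : ∀ μ, g.HasEigenvalue μ → ‖μ‖ ≤ c) :
    ‖LinearMap.trace K V g‖ ≤ Module.finrank K V * c := by
  have hsplit := IsAlgClosed.splits g.charpoly
  rw [Module.End.trace_eq_sum_roots_charpoly_of_splits hsplit, ← g.charpoly_natDegree,
    hsplit.natDegree_eq_card_roots, ← Multiset.card_map (fun μ => ‖μ‖), ← nsmul_eq_mul]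
  refine (norm_multiset_sum_le _).trans (Multiset.sum_le_card_nsmul _ _ ?_)
  rintro _ hx
  obtain ⟨μ, hμ, rfl⟩ := Multiset.mem_map.1 hx
  exact hg μ ((Module.End.hasEigenvalue_iff_isRoot_charpoly _ _).2
    (Polynomial.isRoot_of_mem_roots hμ))

theorem coe_prod_restrict {ι R V : Type*} [Ring R] [AddCommGroup V] [Module R V]
    (f : ι → Module.End R V) (W : Submodule R V) (hW : ∀ i, W ≤ W.comap (f i)) (L : List ι)
    (x : W) : (((L.map fun i => (f i).restrict (hW i)).prod x : W) : V) = (L.map f).prod x := by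
  induction L with
  | nil => simp
  | cons i L ih => simp [Module.End.mul_apply, ih]

theorem prod_mapQ_mk {ι R V : Type*} [Ring R] [AddCommGroup V] [Module R V]
    (f : ι → Module.End R V) (W : Submodule R V) (hW : ∀ i, W ≤ W.comap (f i)) (L : List ι)
    (x : V) : (L.map fun i => W.mapQ W (f i) (hW i)).prod (Submodule.Quotient.mk x) =
      Submodule.Quotient.mk ((L.map f).prod x) := by
  induction L with
  | nil => simp
  | cons i L ih => simp [Module.End.mul_apply, ih]

theorem exists_retraction_section {K V : Type*} [Field K] [AddCommGroup V] [Module K V]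
    (W : Submodule K V) : ∃ (ret : V →ₗ[K] W) (sec : V ⧸ W →ₗ[K] V),
      (∀ w : W, ret w = w) ∧ ∀ v, v = ret v + sec (Submodule.Quotient.mk v) := by
  obtain ⟨ret, hret⟩ := W.subtype.exists_leftInverse_of_injective W.ker_subtype
  have ret_coe (w : W) : ret w = w := LinearMap.congr_fun hret w
  have hker : W ≤ LinearMap.ker (LinearMap.id - W.subtype ∘ₗ ret) := fun w hw => by
    simp [ret_coe ⟨w, hw⟩]
  exact ⟨ret, W.liftQ _ hker, ret_coe, fun v => by simp⟩

theorem seminorm_le_sum_norm_coord {ι K V : Type*} [Fintype ι] [NormedField K] [AddCommGroup V]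
    [Module K V] (b : Module.Basis ι K V) (s : Seminorm K V) (v : V) :
    s v ≤ ∑ i, ‖b.coord i v‖ * s (b i) :=
  calc s v = s (∑ i, b.coord i v • b i) := by simp [b.sum_repr]
    _ ≤ ∑ i, s (b.coord i v • b i) :=
      Finset.le_sum_of_subadditive s (map_zero s).le (map_add_le_add s) _ _
    _ = ∑ i, ‖b.coord i v‖ * s (b i) := by simp only [map_smul_eq_mul]

variable {ι 𝕜 V : Type*} [NontriviallyNormedField 𝕜] [AddCommGroup V] [Module 𝕜 V]

theorem exists_seminorm_le_smul_of_definite [CompleteSpace 𝕜] [FiniteDimensional 𝕜 V]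
    (p s : Seminorm 𝕜 V) (hp : ∀ v, p v = 0 → v = 0) : ∃ K : ℝ≥0, s ≤ K • p := by
  let : NormedAddCommGroup V := AddGroupNorm.toNormedAddCommGroup
    { toFun := p, map_zero' := map_zero p, add_le' := map_add_le_add p, neg' := map_neg_eq_map p,
      eq_zero_of_map_eq_zero' := hp }
  let : NormedSpace 𝕜 V := { norm_smul_le := fun c v => (map_smul_eq_mul p c v).le }
  let b := Module.finBasis 𝕜 V
  let φ := fun i => LinearMap.toContinuousLinearMap (b.coord i)
  refine ⟨∑ i, ‖φ i‖₊ * (s (b i)).toNNReal, fun v => ?_⟩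
  calc s v ≤ ∑ i, ‖φ i v‖ * s (b i) := seminorm_le_sum_norm_coord b s v
    _ ≤ ∑ i, ‖φ i‖ * p v * s (b i) := by
      gcongr with i
      exact (φ i).le_opNorm v
    _ = ∑ i, ‖φ i‖ * s (b i) * p v := by simp only [mul_right_comm]
    _ = (∑ i, ‖φ i‖₊ * (s (b i)).toNNReal : ℝ≥0) * p v := by
      simp [Finset.sum_mul, apply_nonneg]

/-- A family of endomorphisms contracts some norm by a common factor. The norm is encoded as a
definite seminorm, so that it does not interfere with instances on `V`. -/
def IsContractive (f : ι → Module.End 𝕜 V) : Prop :=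
  ∃ (p : Seminorm 𝕜 V) (θ : ℝ≥0), θ < 1 ∧ (∀ v, p v = 0 → v = 0) ∧ ∀ i v, p (f i v) ≤ θ * p v

/-- The eigenvalues of the products of `t` members of the family are `O(θ ^ t)`: the spectral
substitute for a contraction. -/
def HasEigenvalueBound (f : ι → Module.End 𝕜 V) (C θ : ℝ≥0) : Prop :=
  ∀ (w : List ι) (μ : 𝕜), (w.map f).prod.HasEigenvalue μ → ‖μ‖ ≤ C * θ ^ w.length

theorem HasEigenvalueBound.restrict {f : ι → Module.End 𝕜 V} {C θ : ℝ≥0}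
    (hf : HasEigenvalueBound f C θ) (W : Submodule 𝕜 V) (hW : ∀ i, W ≤ W.comap (f i)) :
    HasEigenvalueBound (fun i => (f i).restrict (hW i)) C θ := by
  intro L μ hμ
  obtain ⟨x, hx⟩ := hμ.exists_hasEigenvector
  refine hf L μ (Module.End.hasEigenvalue_of_hasEigenvector (x := (x : V))
    (Module.End.hasEigenvector_iff.2 ⟨Module.End.mem_eigenspace_iff.2 ?_, by simpa using hx.2⟩))
  rw [← coe_prod_restrict f W hW, hx.apply_eq_smul, Submodule.coe_smul]

theorem HasEigenvalueBound.mapQ [FiniteDimensional 𝕜 V] {f : ι → Module.End 𝕜 V} {C θ : ℝ≥0}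
    (hf : HasEigenvalueBound f C θ) (W : Submodule 𝕜 V) (hW : ∀ i, W ≤ W.comap (f i)) :
    HasEigenvalueBound (fun i => W.mapQ W (f i) (hW i)) C θ := by
  intro L μ hμ
  refine hf L μ ?_
  rw [Module.End.hasEigenvalue_iff_mem_spectrum, spectrum.mem_iff] at hμ ⊢
  contrapose! hμ
  rw [Module.End.isUnit_iff] at hμ
  refine (LinearMap.isUnit_iff_range_eq_top _).2 (LinearMap.range_eq_top.2 fun y => ?_)
  obtain ⟨y, rfl⟩ := Submodule.Quotient.mk_surjective W y
  obtain ⟨v, rfl⟩ := hμ.surjective y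
  exact ⟨Submodule.Quotient.mk v, by simp [prod_mapQ_mk, Module.algebraMap_end_apply]⟩

theorem HasEigenvalueBound.exists_norm_trace_le [IsAlgClosed 𝕜] [FiniteDimensional 𝕜 V]
    [Nontrivial V] {f : ι → Module.End 𝕜 V} {C θ : ℝ≥0} (hf : HasEigenvalueBound f C θ)
    (hirr : ∀ W : Submodule 𝕜 V, (∀ i, W ≤ W.comap (f i)) → W = ⊥ ∨ W = ⊤) (X : Module.End 𝕜 V) :
    ∃ D : ℝ, ∀ w : List ι, ‖LinearMap.trace 𝕜 V (X * (w.map f).prod)‖ ≤ D * θ ^ w.length := by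
  have hspan : X ∈ Submodule.span 𝕜 (Submonoid.closure (Set.range f) : Set (Module.End 𝕜 V)) := by
    rw [← Algebra.adjoin_eq_span, Subalgebra.mem_toSubmodule, subalgebra_eq_top_of_irreducible
      (Algebra.adjoin 𝕜 (Set.range f)) fun W hW => hirr W fun i =>
        hW (f i) (Algebra.subset_adjoin ⟨i, rfl⟩)]
    trivial
  induction hspan using Submodule.span_induction with
  | mem X hX =>
    obtain ⟨L, hL, rfl⟩ := Submonoid.exists_list_of_mem_closure hX
    obtain ⟨u, rfl⟩ : L ∈ Set.range (List.map f) := by rwa [Set.range_list_map]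
    refine ⟨Module.finrank 𝕜 V * (C * θ ^ u.length), fun w => ?_⟩
    rw [← List.prod_append, ← List.map_append]
    refine (norm_trace_le _ (hf (u ++ w))).trans_eq ?_
    rw [List.length_append]
    ring
  | zero => exact ⟨0, by simp⟩
  | add X Y _ _ hX hY =>
    obtain ⟨⟨D, hD⟩, E, hE⟩ := hX, hY
    refine ⟨D + E, fun w => ?_⟩
    rw [add_mul, map_add, add_mul]
    exact (norm_add_le _ _).trans (add_le_add (hD w) (hE w))
  | smul c X _ hX =>
    obtain ⟨D, hD⟩ := hX
    refine ⟨‖c‖ * D, fun w => ?_⟩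
    rw [smul_mul_assoc, map_smul, norm_smul, mul_assoc]
    exact mul_le_mul_of_nonneg_left (hD w) (norm_nonneg _)

/-- The entries of the products are traces of products with rank-one endomorphisms. -/
theorem HasEigenvalueBound.exists_norm_dual_le [IsAlgClosed 𝕜] [FiniteDimensional 𝕜 V]
    [Nontrivial V] {f : ι → Module.End 𝕜 V} {C θ : ℝ≥0} (hf : HasEigenvalueBound f C θ)
    (hirr : ∀ W : Submodule 𝕜 V, (∀ i, W ≤ W.comap (f i)) → W = ⊥ ∨ W = ⊤)
    (φ : Module.Dual 𝕜 V) (v : V) :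
    ∃ D : ℝ, ∀ w : List ι, ‖φ ((w.map f).prod v)‖ ≤ D * θ ^ w.length := by
  obtain ⟨D, hD⟩ := hf.exists_norm_trace_le hirr (φ.smulRight v)
  refine ⟨D, fun w => ?_⟩
  have hmul : (w.map f).prod * φ.smulRight v = φ.smulRight ((w.map f).prod v) := by
    ext x
    simp
  rw [← LinearMap.trace_smulRight, ← hmul, LinearMap.trace_mul_comm]
  exact hD w

theorem HasEigenvalueBound.exists_seminorm_le [IsAlgClosed 𝕜] [FiniteDimensional 𝕜 V]
    [Nontrivial V] {f : ι → Module.End 𝕜 V} {C θ : ℝ≥0} (hf : HasEigenvalueBound f C θ)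
    (hirr : ∀ W : Submodule 𝕜 V, (∀ i, W ≤ W.comap (f i)) → W = ⊥ ∨ W = ⊤)
    (s : Seminorm 𝕜 V) (v : V) :
    ∃ D : ℝ, ∀ w : List ι, s ((w.map f).prod v) ≤ D * θ ^ w.length := by
  let b := Module.finBasis 𝕜 V
  choose D hD using fun i => hf.exists_norm_dual_le hirr (b.coord i) v
  refine ⟨∑ i, D i * s (b i), fun w => (seminorm_le_sum_norm_coord b s _).trans ?_⟩
  rw [Finset.sum_mul]
  refine Finset.sum_le_sum fun i _ => ?_
  rw [mul_right_comm]
  exact mul_le_mul_of_nonneg_right (hD i w) (apply_nonneg _ _)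

/-- The contracted norm is `v ↦ sup_w θ⁻ˡᵉⁿᵍᵗʰ⁽ʷ⁾ s (f_w v)`. -/
theorem isContractive_of_seminorm_prod_le {f : ι → Module.End 𝕜 V} {θ : ℝ≥0} (hθ : 0 < θ)
    (hθ1 : θ < 1) (s : Seminorm 𝕜 V) (hs : ∀ v, s v = 0 → v = 0)
    (hf : ∀ v, ∃ D : ℝ, ∀ w : List ι, s ((w.map f).prod v) ≤ D * θ ^ w.length) :
    IsContractive f := by
  let q : List ι → Seminorm 𝕜 V := fun w => θ⁻¹ ^ w.length • s.comp (w.map f).prod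
  have q_apply (w : List ι) (v : V) : q w v = (θ : ℝ)⁻¹ ^ w.length * s ((w.map f).prod v) := by
    simp [q, NNReal.smul_def]
  have bdd (v : V) : BddAbove (Set.range fun w => q w v) := by
    obtain ⟨D, hD⟩ := hf v
    refine ⟨D, Set.forall_mem_range.2 fun w => ?_⟩
    rw [q_apply, inv_pow, inv_mul_le_iff₀ (by positivity), mul_comm]
    exact hD w
  have sup_apply (v : V) : (⨆ w, q w) v = ⨆ w, q w v :=
    Seminorm.iSup_apply (Seminorm.bddAbove_range_iff.2 bdd)
  refine ⟨⨆ w, q w, θ, hθ1, fun v hv => hs v (le_antisymm ?_ (apply_nonneg s v)), fun i v => ?_⟩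
  · rw [sup_apply] at hv
    simpa [q_apply] using (le_ciSup (bdd v) []).trans_eq hv
  · rw [sup_apply, sup_apply]
    refine ciSup_le fun w => ?_
    have hwi : (θ : ℝ)⁻¹ ^ (w.length + 1) * s ((w.map f).prod (f i v)) ≤ ⨆ w, q w v := by
      simpa [q_apply] using le_ciSup (bdd v) (w ++ [i])
    rw [q_apply, ← inv_mul_le_iff₀ (by exact_mod_cast hθ), ← mul_assoc, ← pow_succ']
    exact hwi

theorem HasEigenvalueBound.isContractive_of_irreducible [IsAlgClosed 𝕜] [FiniteDimensional 𝕜 V]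
    [Nontrivial V] {f : ι → Module.End 𝕜 V} {C θ : ℝ≥0} (hf : HasEigenvalueBound f C θ)
    (hθ : 0 < θ) (hθ1 : θ < 1)
    (hirr : ∀ W : Submodule 𝕜 V, (∀ i, W ≤ W.comap (f i)) → W = ⊥ ∨ W = ⊤) :
    IsContractive f := by
  let e := (Module.finBasis 𝕜 V).equivFun
  refine isContractive_of_seminorm_prod_le hθ hθ1
    ((normSeminorm 𝕜 (Fin (Module.finrank 𝕜 V) → 𝕜)).comp e.toLinearMap) (fun v hv => ?_)
    (hf.exists_seminorm_le hirr _)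
  simpa using hv

theorem exists_weight {θ τ : ℝ≥0} (hθ : θ < τ) (K : ℝ≥0) :
    ∃ M : ℝ≥0, 0 < M ∧ K + M * θ ≤ τ * M := by
  have hgap : 0 < τ - θ := tsub_pos_of_lt hθ
  refine ⟨K / (τ - θ) + 1, by positivity, ?_⟩
  calc K + (K / (τ - θ) + 1) * θ
      ≤ (K / (τ - θ) + 1) * (τ - θ) + (K / (τ - θ) + 1) * θ := by
        gcongr
        rw [add_mul, div_mul_cancel₀ _ hgap.ne']
        exact le_self_add
    _ = τ * (K / (τ - θ) + 1) := by rw [← mul_add, tsub_add_cancel_of_le hθ.le, mul_comm]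

/-- A large multiple of the norm on the quotient absorbs the off-diagonal block. -/
theorem isContractive_of_invariant [CompleteSpace 𝕜] [FiniteDimensional 𝕜 V] [Finite ι]
    {f : ι → Module.End 𝕜 V} (W : Submodule 𝕜 V) (hW : ∀ i, W ≤ W.comap (f i))
    (hsub : IsContractive fun i => (f i).restrict (hW i))
    (hquot : IsContractive fun i => W.mapQ W (f i) (hW i)) : IsContractive f := by
  obtain ⟨p, θ, hθ, p_def, hp⟩ := hsub
  obtain ⟨p', θ', hθ', p'_def, hp'⟩ := hquot
  obtain ⟨ret, sec, ret_coe, decomp⟩ := exists_retraction_section W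
  choose K hK using fun i => exists_seminorm_le_smul_of_definite p' (p.comp (ret ∘ₗ f i ∘ₗ sec))
    p'_def
  have := Fintype.ofFinite ι
  obtain ⟨τ, hτ, hτ1⟩ := exists_between (max_lt hθ hθ')
  obtain ⟨M, hM, hKM⟩ := exists_weight ((le_max_right θ θ').trans_lt hτ) (Finset.univ.sup K)
  have off_diag (i : ι) (v : V) : p (ret (f i v)) ≤ θ * p (ret v) +
      (Finset.univ.sup K : ℝ≥0) * p' (Submodule.Quotient.mk v) := by
    have hret : ret (f i v) = (f i).restrict (hW i) (ret v) +
        ret (f i (sec (Submodule.Quotient.mk v))) := by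
      conv_lhs => rw [decomp v, map_add, map_add]
      exact congrArg (· + _) (ret_coe ((f i).restrict (hW i) (ret v)))
    rw [hret]
    refine (map_add_le_add p _ _).trans (add_le_add (hp i _) ((hK i _).trans ?_))
    exact mul_le_mul_of_nonneg_right (NNReal.coe_le_coe.2 (Finset.le_sup (Finset.mem_univ i)))
      (apply_nonneg p' _)
  refine ⟨p.comp ret + M • p'.comp W.mkQ, τ, hτ1, fun v hv => ?_, fun i v => ?_⟩
  · change p (ret v) + M * p' (Submodule.Quotient.mk v) = 0 at hv
    obtain ⟨hret, hmk⟩ := (add_eq_zero_iff_of_nonneg (apply_nonneg p _)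
      (mul_nonneg M.coe_nonneg (apply_nonneg p' _))).1 hv
    rw [decomp v, p_def _ hret, p'_def _ ((mul_eq_zero_iff_left (by positivity)).1 hmk)]
    simp
  · change p (ret (f i v)) + M * p' (Submodule.Quotient.mk (f i v)) ≤
      τ * (p (ret v) + M * p' (Submodule.Quotient.mk v))
    have hθτ : (θ : ℝ) ≤ τ := NNReal.coe_le_coe.2 ((le_max_left _ _).trans hτ.le)
    have hKM' : ((Finset.univ.sup K : ℝ≥0) + M * θ' : ℝ) ≤ τ * M := by exact_mod_cast hKM
    have hmk : p' (Submodule.Quotient.mk (f i v)) ≤ θ' * p' (Submodule.Quotient.mk v) :=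
      hp' i (Submodule.Quotient.mk v)
    set a := p (ret v)
    set b := p' (Submodule.Quotient.mk v)
    calc p (ret (f i v)) + M * p' (Submodule.Quotient.mk (f i v))
        ≤ θ * a + (Finset.univ.sup K : ℝ≥0) * b + M * (θ' * b) := by
          gcongr
          exact off_diag i v
      _ = θ * a + ((Finset.univ.sup K : ℝ≥0) + M * θ') * b := by ring
      _ ≤ τ * a + τ * M * b := by gcongr
      _ = τ * (a + M * b) := by ring

theorem HasEigenvalueBound.isContractive [IsAlgClosed 𝕜] [CompleteSpace 𝕜] [FiniteDimensional 𝕜 V]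
    [Finite ι] {f : ι → Module.End 𝕜 V} {C θ : ℝ≥0} (hf : HasEigenvalueBound f C θ) (hθ : 0 < θ)
    (hθ1 : θ < 1) : IsContractive f := by
  induction hn : Module.finrank 𝕜 V using Nat.strong_induction_on generalizing V with
  | _ n ih =>
    subst hn
    cases subsingleton_or_nontrivial V with
    | inl _ => exact ⟨0, 0, zero_lt_one, fun v _ => Subsingleton.elim _ _, fun i v => by simp⟩
    | inr _ =>
      by_cases hirr : ∀ W : Submodule 𝕜 V, (∀ i, W ≤ W.comap (f i)) → W = ⊥ ∨ W = ⊤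
      · exact hf.isContractive_of_irreducible hθ hθ1 hirr
      push Not at hirr
      obtain ⟨W, hW, hbot, htop⟩ := hirr
      have hpos : 0 < Module.finrank 𝕜 W :=
        Nat.pos_of_ne_zero (mt Submodule.finrank_eq_zero.1 hbot)
      have hsum := W.finrank_quotient_add_finrank
      exact isContractive_of_invariant W hW
        (ih _ (Submodule.finrank_lt htop) (hf.restrict W hW) rfl)
        (ih _ (by omega) (hf.mapQ W hW) rfl)

theorem exists_hasEigenvalueBound_of_long_words [FiniteDimensional 𝕜 V] [Finite ι]
    {f : ι → Module.End 𝕜 V} {θ : ℝ≥0} (hθ : 0 < θ) (T : ℕ)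
    (hf : ∀ w : List ι, T ≤ w.length → ∀ μ, (w.map f).prod.HasEigenvalue μ →
      ‖μ‖ ≤ θ ^ w.length) : ∃ C, HasEigenvalueBound f C θ := by
  obtain ⟨C, hC⟩ := ((List.finite_length_le ι T).biUnion fun w _ =>
    (Module.End.finite_hasEigenvalue (w.map f).prod).image
      fun μ => ‖μ‖₊ / θ ^ w.length).bddAbove
  refine ⟨max C 1, fun w μ hμ => ?_⟩
  rw [← coe_nnnorm]
  norm_cast
  rcases le_total T w.length with hw | hw
  · exact (NNReal.coe_le_coe.1 (by simpa using hf w hw μ hμ)).trans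
      (le_mul_of_one_le_left' (le_max_right C 1))
  · rw [← div_le_iff₀ (pow_pos hθ _)]
    exact (hC (Set.mem_biUnion hw ⟨μ, hμ, rfl⟩)).trans (le_max_left C 1)

end BergerWang

section JointSpectralRadius

variable {N : Type*} [Fintype N] [DecidableEq N]

theorem prod_map_toLin' {R : Type*} [CommSemiring R] (L : List (Matrix N N R)) :
    (L.map Matrix.toLin').prod = Matrix.toLin' L.prod :=
  (map_list_prod (Matrix.toLinAlgEquiv' (R := R) (n := N)) L).symm

theorem nnnorm_le_spectralRadius_of_hasEigenvalue (A : Matrix N N ℂ) {μ : ℂ}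
    (hμ : Module.End.HasEigenvalue (Matrix.toLin' A) μ) : (‖μ‖₊ : ℝ≥0∞) ≤ spectralRadius ℂ A :=
  le_iSup₂ (f := fun k (_ : k ∈ spectrum ℂ A) => (‖k‖₊ : ℝ≥0∞)) μ
    (Matrix.spectrum_toLin' A ▸ hμ.mem_spectrum)

theorem exists_hasEigenvalueBound_of_jointSpectralRadius_lt_one {S : Set (Matrix N N ℝ)}
    (hS : S.Finite) (h : jointSpectralRadius S < 1) : ∃ C θ : ℝ≥0, 0 < θ ∧ θ < 1 ∧
      HasEigenvalueBound (fun A : S => Matrix.toLin' (A.1.map (algebraMap ℝ ℂ))) C θ := by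
  obtain ⟨θ, hθ, hθ1⟩ := ENNReal.lt_iff_exists_nnreal_btwn.1 h
  have hθ0 : 0 < θ := ENNReal.coe_pos.1 (pos_of_gt hθ)
  obtain ⟨T, hT⟩ := eventually_atTop.1 (eventually_lt_of_limsup_lt hθ)
  have := hS.to_subtype
  let f := fun A : S => Matrix.toLin' (A.1.map (algebraMap ℝ ℂ))
  suffices long_words : ∀ w : List S, max T 1 ≤ w.length → ∀ μ,
      Module.End.HasEigenvalue (w.map f).prod μ → ‖μ‖ ≤ θ ^ w.length by
    obtain ⟨C, hC⟩ := exists_hasEigenvalueBound_of_long_words hθ0 (max T 1) long_words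
    exact ⟨C, θ, hθ0, by exact_mod_cast hθ1, hC⟩
  intro w hw μ hμ
  have hprod : (w.map f).prod =
      Matrix.toLin' ((w.map Subtype.val).prod.map (algebraMap ℝ ℂ)) := by
    rw [← RingHom.mapMatrix_apply, map_list_prod, ← prod_map_toLin', List.map_map, List.map_map]
    rfl
  have hlen : (0 : ℝ) < w.length := by exact_mod_cast (le_max_right T 1).trans hw
  have hroot : spectralRadius ℂ ((w.map Subtype.val).prod.map (algebraMap ℝ ℂ)) ^
      (1 / (w.length : ℝ)) ≤ θ := by
    refine le_trans ?_ (hT w.length ((le_max_left T 1).trans hw)).le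
    exact le_iSup₂ (f := fun (L : List (Matrix N N ℝ)) (_ : L ∈ {L : List (Matrix N N ℝ) |
      L.length = w.length ∧ ∀ A ∈ L, A ∈ S}) =>
        spectralRadius ℂ (L.prod.map (algebraMap ℝ ℂ)) ^ (1 / (w.length : ℝ)))
      (w.map Subtype.val) ⟨by simp, by simp +contextual⟩
  rw [one_div, ENNReal.rpow_inv_le_iff hlen, ENNReal.rpow_natCast] at hroot
  have hμθ := (nnnorm_le_spectralRadius_of_hasEigenvalue _ (hprod ▸ hμ)).trans hroot
  rw [← coe_nnnorm]
  exact_mod_cast hμθ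

theorem exists_contracting_seminorm {S : Set (Matrix N N ℝ)} (hS : S.Finite)
    (h : jointSpectralRadius S < 1) : ∃ (p : Seminorm ℝ (N → ℝ)) (θ K : ℝ≥0), θ < 1 ∧
      (∀ v, ‖v‖ ≤ K * p v) ∧ (∀ v, p v ≤ K * ‖v‖) ∧ ∀ A ∈ S, ∀ v, p (A *ᵥ v) ≤ θ * p v := by
  obtain ⟨C, τ, hτ, hτ1, hbound⟩ := exists_hasEigenvalueBound_of_jointSpectralRadius_lt_one hS h
  have := hS.to_subtype
  obtain ⟨p, θ, hθ1, p_def, hp⟩ := hbound.isContractive hτ hτ1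
  obtain ⟨K, hK⟩ := exists_seminorm_le_smul_of_definite p (normSeminorm ℂ (N → ℂ)) p_def
  obtain ⟨K', hK'⟩ := exists_seminorm_le_smul_of_definite (normSeminorm ℂ (N → ℂ)) p
    fun v hv => norm_eq_zero.1 hv
  let e : (N → ℝ) →ₗ[ℝ] (N → ℂ) := (Complex.ofRealCLM : ℝ →ₗ[ℝ] ℂ).compLeft N
  have norm_e (v : N → ℝ) : ‖e v‖ = ‖v‖ := by simp [e, Pi.norm_def]
  refine ⟨(p.restrictScalars ℝ).comp e, θ, max K K', hθ1, fun v => ?_, fun v => ?_,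
    fun A hA v => ?_⟩
  · rw [← norm_e]
    exact (hK (e v)).trans (mul_le_mul_of_nonneg_right
      (NNReal.coe_le_coe.2 (le_max_left K K')) (apply_nonneg p _))
  · rw [← norm_e]
    exact (hK' (e v)).trans (mul_le_mul_of_nonneg_right
      (NNReal.coe_le_coe.2 (le_max_right K K')) (apply_nonneg _ _))
  · have hmap : e (A *ᵥ v) = Matrix.toLin' (A.map (algebraMap ℝ ℂ)) (e v) := by
      ext i
      simp [e, Matrix.mulVec, dotProduct]
    change p (e (A *ᵥ v)) ≤ θ * p (e v)
    exact hmap ▸ hp ⟨A, hA⟩ (e v)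

end JointSpectralRadius

/-! ### The error-correction form -/

theorem colCons_mulVec {m : Type*} {d : ℕ} (v : m → ℝ) (A : Matrix m (Fin d) ℝ)
    (x : Fin (d + 1) → ℝ) : colCons v A *ᵥ x = x 0 • v + A *ᵥ fun j => x j.succ := by
  ext a
  simp [colCons, Matrix.mulVec, dotProduct, Fin.sum_univ_succ, mul_comm]

theorem sum_range_lag_sub {E : Type*} [AddCommGroup E] (x : ℤ → E) (t : ℤ) (k : ℕ) :
    ∑ j ∈ Finset.range k, (x (t - j) - x (t - j - 1)) = x t - x (t - k) := by
  simpa [sub_sub] using Finset.sum_range_sub' (fun j : ℕ => x (t - j)) k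

theorem sum_mulVec_lags {R m n : Type*} [Ring R] [Fintype n] (A : ℕ → Matrix m n R)
    (x : ℤ → n → R) (t : ℤ) (K : ℕ) :
    ∑ i ∈ Finset.Icc 1 (K + 1), A i *ᵥ x (t + 1 - i) =
      (∑ i ∈ Finset.Icc 1 (K + 1), A i) *ᵥ x t +
        ∑ j ∈ Finset.range K, (-∑ i ∈ Finset.Icc (j + 1 + 1) (K + 1), A i) *ᵥ
          (x (t - j) - x (t - j - 1)) := by
  have lag (i : ℕ) (hi : i ∈ Finset.Icc 1 (K + 1)) : A i *ᵥ x (t + 1 - i) =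
      A i *ᵥ x t - ∑ j ∈ Finset.range (i - 1), A i *ᵥ (x (t - j) - x (t - j - 1)) := by
    obtain ⟨i, rfl⟩ := Nat.exists_eq_add_of_le' (Finset.mem_Icc.1 hi).1
    rw [← Matrix.mulVec_sum, Nat.add_sub_cancel, sum_range_lag_sub, ← Matrix.mulVec_sub,
      sub_sub_cancel]
    push_cast
    rw [add_sub_add_right_eq_sub]
  rw [Finset.sum_congr rfl lag, Finset.sum_sub_distrib, Finset.sum_comm' (t' := Finset.range K)
    (s' := fun j => Finset.Icc (j + 1 + 1) (K + 1))
    (by simp only [Finset.mem_Icc, Finset.mem_range]; omega)]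
  simp only [Matrix.neg_mulVec, Matrix.sum_mulVec, Finset.sum_neg_distrib, sub_eq_add_neg]

/-- The negative part `y_t⁻` of the first coordinate of a path. -/
abbrev yNeg {d : ℕ} (z : ℤ → Fin (d + 1) → ℝ) (t : ℤ) : ℝ := min (z t 0) 0

/-- Where the convex combinations of `F 0` and `F 1` come from: `y_t⁻` is a fraction of the gap
`y_t - y_{t-1}⁺`. -/
theorem exists_regime_weight (a b : ℝ) :
    ∃ δ ∈ Set.Icc (0 : ℝ) 1, min b 0 = δ * (b - max a 0) := by
  have ha : 0 ≤ max a 0 := le_max_right a 0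
  rcases le_or_gt 0 b with hb | hb
  · exact ⟨0, by simp, by simp [hb]⟩
  · have hgap : b - max a 0 < 0 := by linarith
    refine ⟨b / (b - max a 0), ⟨div_nonneg_of_nonpos hb.le hgap.le, ?_⟩, ?_⟩
    · rw [div_le_one_of_neg hgap]
      linarith
    · rw [div_mul_cancel₀ _ hgap.ne, min_eq_left hb.le]

namespace CKSVAR

section ErrorCorrection

variable {d l : ℕ} (M : CKSVAR d l)

/-- The equations of the model along a single path. -/
def IsPath (u : ℕ → Fin (d + 1) → ℝ) (z : ℤ → Fin (d + 1) → ℝ) : Prop :=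
  ∀ t : ℕ, 1 ≤ t → z t = M.c + ∑ i ∈ Finset.Icc 1 (l + 2),
    (max (z (t - i) 0) 0 • M.phi .pos i + min (z (t - i) 0) 0 • M.phi .neg i
      + M.PhiX i *ᵥ (fun j => z (t - i) j.succ)) + u t

/-- The nonlinear part `∑ᵢ y_{t-i}⁻ (φᵢ⁻ - φᵢ⁺)` of the model, when the positive regime is taken as
the reference. -/
def regimeTerm (z : ℤ → Fin (d + 1) → ℝ) (t : ℤ) : Fin (d + 1) → ℝ :=
  ∑ i ∈ Finset.Icc 1 (l + 2), yNeg z (t - i) • M.phiDiff i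

theorem regime_summand_eq (i : ℕ) (x : Fin (d + 1) → ℝ) :
    max (x 0) 0 • M.phi .pos i + min (x 0) 0 • M.phi .neg i + M.PhiX i *ᵥ (fun j => x j.succ) =
      M.Phi .pos i *ᵥ x + min (x 0) 0 • M.phiDiff i := by
  have hmax : max (x 0) 0 = x 0 - min (x 0) 0 := by rw [eq_sub_iff_add_eq, max_add_min, add_zero]
  rw [Phi, colCons_mulVec, phiDiff, hmax]
  module

theorem piMat_eq (s : Regime) : M.PiMat s = -(1 - ∑ i ∈ Finset.Icc 1 (l + 2), M.Phi s i) := by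
  ext a b
  cases b using Fin.cases <;>
    simp [PiMat, colCons, pi, PiX, Phi, Matrix.sum_apply, Matrix.one_apply, Pi.single_apply]

variable {M}

theorem IsPath.errorCorrection {u : ℕ → Fin (d + 1) → ℝ} {z : ℤ → Fin (d + 1) → ℝ}
    (h : M.IsPath u z) (t : ℕ) :
    z (t + 1) = z t + M.PiMat .pos *ᵥ z t +
      ∑ m ∈ Finset.range (l + 1), M.Gamma .pos (m + 1) *ᵥ (z (t - m) - z (t - m - 1)) +
      (M.regimeTerm z (t + 1) + (M.c + u (t + 1))) := by
  have hstep := h (t + 1) (Nat.le_add_left 1 t)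
  simp only [M.regime_summand_eq, Finset.sum_add_distrib, Nat.cast_add, Nat.cast_one,
    sum_mulVec_lags (M.Phi .pos) z t (l + 1)] at hstep
  rw [hstep, piMat_eq, Matrix.neg_mulVec, Matrix.sub_mulVec, Matrix.one_mulVec]
  simp only [Gamma, regimeTerm, yNeg]
  abel

end ErrorCorrection

/-! ### The companion form of the short-memory components -/

section Companion

variable {d l r : ℕ} (M : CKSVAR d l) (α β : Matrix (Fin (d + 1)) (Fin r) ℝ)

/-- The vector `(z_t, …, z_{t-k+1})`. -/
def stack (l : ℕ) (z : ℤ → Fin (d + 1) → ℝ) (t : ℤ) : Fin (l + 2) × Fin (d + 1) → ℝ :=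
  fun ja => z (t - (ja.1 : ℕ)) ja.2

/-- The stacked vector `(g, 0, …, 0)`. -/
def topBlock (l : ℕ) (g : Fin (d + 1) → ℝ) : Fin (l + 2) × Fin (d + 1) → ℝ :=
  fun ja => if ja.1 = 0 then g ja.2 else 0

/-- The equilibrium errors and the differences `(βᵀ z_t, Δz_t, …, Δz_{t-k+2})`. -/
def shortMemory (l : ℕ) (z : ℤ → Fin (d + 1) → ℝ) (t : ℤ) :
    Fin r ⊕ Fin (l + 1) × Fin (d + 1) → ℝ :=
  Sum.elim (βᵀ *ᵥ z t) (fun ma => z (t - (ma.1 : ℕ)) ma.2 - z (t - (ma.1 : ℕ) - 1) ma.2)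

/-- The state vector on which the matrices `F δ` act: the short-memory components, the gap
`y_t - y_{t-1}⁺` and the lags `y_{t-1}⁻, …, y_{t-k+1}⁻`. -/
def state (l : ℕ) (z : ℤ → Fin (d + 1) → ℝ) (t : ℤ) :
    (Fin r ⊕ Fin (l + 1) × Fin (d + 1)) ⊕ (Unit ⊕ Fin (l + 1)) → ℝ :=
  Sum.elim (shortMemory β l z t)
    (Sum.elim (fun _ => z t 0 - max (z (t - 1) 0) 0) (fun i => yNeg z (t - 1 - (i : ℕ))))

/-- The effect of the shocks on the state vector. -/
def shockMatrix (l : ℕ) :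
    Matrix ((Fin r ⊕ Fin (l + 1) × Fin (d + 1)) ⊕ (Unit ⊕ Fin (l + 1))) (Fin (d + 1)) ℝ :=
  Matrix.fromRows (boldBetaTopT (l := l) β)
    (Matrix.fromRows (Matrix.of fun _ => Pi.single 0 1) 0)

theorem boldBetaT_inr_apply (m : Fin (l + 1)) (a : Fin (d + 1)) (j : Fin (l + 2))
    (b : Fin (d + 1)) : boldBetaT (l := l) β (Sum.inr (m, a)) (j, b) =
      (if j = m.castSucc then (1 : Matrix (Fin (d + 1)) (Fin (d + 1)) ℝ) a b else 0) -
        (if j = m.succ then (1 : Matrix (Fin (d + 1)) (Fin (d + 1)) ℝ) a b else 0) := by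
  have hne := (Fin.castSucc_lt_succ (i := m)).ne
  by_cases hj : j = m.castSucc
  · simp [boldBetaT, hj, hne]
  · by_cases hj' : j = m.succ <;> simp [boldBetaT, hj, hj', hne.symm]

theorem boldBetaT_mulVec_stack (z : ℤ → Fin (d + 1) → ℝ) (t : ℤ) :
    boldBetaT (l := l) β *ᵥ stack l z t = shortMemory β l z t := by
  ext (b | ⟨m, a⟩)
  · simp [boldBetaT, stack, shortMemory, Matrix.mulVec, dotProduct, Fintype.sum_prod_type,
      ite_mul, Fin.sum_univ_succ (n := l + 1), Fin.succ_ne_zero]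
  · simp only [Matrix.mulVec, dotProduct, Fintype.sum_prod_type_right, boldBetaT_inr_apply, sub_mul,
      ite_mul, zero_mul, Finset.sum_sub_distrib, Matrix.one_apply, Finset.sum_ite_eq',
      Finset.mem_univ, if_true]
    simp [stack, shortMemory, sub_sub]

theorem boldBetaT_mulVec_topBlock (g : Fin (d + 1) → ℝ) :
    boldBetaT (l := l) β *ᵥ topBlock l g = boldBetaTopT (l := l) β *ᵥ g := by
  ext i
  simp [boldBetaTopT, topBlock, Matrix.mulVec, dotProduct, Fintype.sum_prod_type,
    Fin.sum_univ_succ (n := l + 1), Fin.succ_ne_zero]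

theorem boldAlpha_mulVec_zero (z : ℤ → Fin (d + 1) → ℝ) (t : ℤ) (a : Fin (d + 1)) :
    (M.boldAlpha α *ᵥ shortMemory β l z t) (0, a) =
      ((α * βᵀ) *ᵥ z t + ∑ m ∈ Finset.range (l + 1),
        M.Gamma .pos (m + 1) *ᵥ (z (t - m) - z (t - m - 1))) a := by
  rw [← Matrix.mulVec_mulVec, Finset.sum_range]
  simp [boldAlpha, shortMemory, Matrix.mulVec, dotProduct, Fintype.sum_prod_type, Finset.sum_apply,
    -Matrix.mulVec_mulVec]

theorem boldAlpha_mulVec_succ (z : ℤ → Fin (d + 1) → ℝ) (t : ℤ) (j : Fin (l + 1))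
    (a : Fin (d + 1)) : (M.boldAlpha α *ᵥ shortMemory β l z t) (j.succ, a) =
      z (t - (j : ℕ)) a - z (t - (j : ℕ) - 1) a := by
  simp only [boldAlpha, Matrix.mulVec, dotProduct, Fintype.sum_sum_type, Matrix.of_apply,
    Fin.succ_ne_zero, if_false, Sum.elim_inl, Sum.elim_inr, zero_mul, Finset.sum_const_zero,
    zero_add, Fintype.sum_prod_type_right, Fin.succ_inj, ite_mul, Matrix.one_apply]
  simp [shortMemory]

theorem F_mulVec (δ : ℝ) (x : Fin r ⊕ Fin (l + 1) × Fin (d + 1) → ℝ) (g : ℝ)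
    (w : Fin (l + 1) → ℝ) :
    M.F α β δ *ᵥ Sum.elim x (Sum.elim (fun _ => g) w) =
      Sum.elim
        (x + boldBetaT (l := l) β *ᵥ (M.boldAlpha α *ᵥ x) + boldBetaTopT (l := l) β *ᵥ
          ((δ * g) • M.phiDiff 1 + ∑ i : Fin (l + 1), w i • M.phiDiff (i + 2)))
        (Sum.elim
          (fun _ => (M.boldAlpha α *ᵥ x) (0, 0) + δ * g +
            ((δ * g) • M.phiDiff 1 + ∑ i : Fin (l + 1), w i • M.phiDiff (i + 2)) 0)
          (Fin.cons (δ * g) fun i : Fin l => w i.castSucc)) := by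
  rw [F, Matrix.fromBlocks_mulVec, Matrix.fromBlocks_mulVec]
  simp only [Sum.elim_comp_inl, Sum.elim_comp_inr]
  congr 1
  · rw [Matrix.add_mulVec, Matrix.one_mulVec, Matrix.mulVec_mulVec, Matrix.mulVec_add,
      Matrix.mulVec_smul, Matrix.mulVec_sum]
    congr 1
    ext a
    simp [Matrix.mulVec_smul, Matrix.mulVec, dotProduct, mul_comm, mul_assoc, mul_left_comm]
  · ext (_ | i)
    · simp [Matrix.mulVec, dotProduct, mul_comm]
      ring
    · cases i using Fin.cases with
      | zero => simp [Matrix.mulVec, dotProduct]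
      | succ i =>
        have hlag (j : Fin (l + 1)) : ((i.succ : Fin (l + 1)) : ℕ) = j + 1 ↔ i.castSucc = j := by
          simp [Fin.ext_iff]
        simp [Matrix.mulVec, dotProduct, hlag, -Fin.val_succ]

theorem F_eq_combination (δ : ℝ) : M.F α β δ = (1 - δ) • M.F α β 0 + δ • M.F α β 1 := by
  ext (i | i | i) (j | j | j) <;>
    simp only [F, Matrix.fromBlocks, Matrix.of_apply, Matrix.add_apply, Matrix.smul_apply,
      Sum.elim_inl, Sum.elim_inr, Pi.zero_apply, smul_eq_mul] <;>
    grind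

theorem regimeTerm_succ (z : ℤ → Fin (d + 1) → ℝ) (t : ℤ) : M.regimeTerm z (t + 1) =
    yNeg z t • M.phiDiff 1 +
      ∑ i : Fin (l + 1), yNeg z (t - 1 - (i : ℕ)) • M.phiDiff (i + 2) := by
  rw [regimeTerm, ← Finset.Ico_add_one_right_eq_Icc, Finset.sum_Ico_eq_sum_range,
    show l + 2 + 1 - 1 = l + 1 + 1 by omega, Finset.sum_range_succ', Finset.sum_range,
    add_comm (Finset.sum _ _)]
  congr 1
  · simp
  · refine Finset.sum_congr rfl fun i _ => ?_
    rw [show (t : ℤ) + 1 - ((1 + ((i : ℕ) + 1) : ℕ) : ℤ) = t - 1 - (i : ℕ) by push_cast; ring,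
      show 1 + ((i : ℕ) + 1) = i + 2 by omega]

end Companion

section CompanionForm

variable {d l r : ℕ} {M : CKSVAR d l} {α β : Matrix (Fin (d + 1)) (Fin r) ℝ}
  {u : ℕ → Fin (d + 1) → ℝ} {z : ℤ → Fin (d + 1) → ℝ}

theorem IsPath.stack_succ (h : M.IsPath u z) (hαβ : M.PiMat .pos = α * βᵀ) (t : ℕ) :
    stack l z (t + 1) = stack l z t + M.boldAlpha α *ᵥ shortMemory β l z t +
      topBlock l (M.regimeTerm z (t + 1) + (M.c + u (t + 1))) := by
  ext ⟨j, a⟩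
  cases j using Fin.cases with
  | zero =>
    rw [Pi.add_apply, Pi.add_apply, boldAlpha_mulVec_zero, ← hαβ]
    simp only [stack, topBlock, Fin.val_zero, Nat.cast_zero, sub_zero, if_true]
    rw [h.errorCorrection t]
    simp only [Pi.add_apply, add_assoc]
  | succ j =>
    have hlag : (t : ℤ) + 1 - (j.succ : ℕ) = t - j := by simp
    rw [Pi.add_apply, Pi.add_apply, boldAlpha_mulVec_succ]
    simp only [stack, topBlock, hlag, Fin.succ_ne_zero, if_false, add_zero]
    simp [← sub_sub]

theorem IsPath.shortMemory_succ (h : M.IsPath u z) (hαβ : M.PiMat .pos = α * βᵀ) (t : ℕ) :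
    shortMemory β l z (t + 1) = shortMemory β l z t +
      boldBetaT (l := l) β *ᵥ (M.boldAlpha α *ᵥ shortMemory β l z t) +
      boldBetaTopT (l := l) β *ᵥ (M.regimeTerm z (t + 1) + (M.c + u (t + 1))) := by
  rw [← boldBetaT_mulVec_stack, h.stack_succ hαβ, Matrix.mulVec_add, Matrix.mulVec_add,
    boldBetaT_mulVec_topBlock, boldBetaT_mulVec_stack]

theorem IsPath.state_succ (h : M.IsPath u z) (hαβ : M.PiMat .pos = α * βᵀ) (t : ℕ) :
    ∃ δ ∈ Set.Icc (0 : ℝ) 1, state β l z (t + 1) =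
      M.F α β δ *ᵥ state β l z t + shockMatrix β l *ᵥ (M.c + u (t + 1)) := by
  obtain ⟨δ, hδ, hgap⟩ := exists_regime_weight (z (t - 1) 0) (z t 0)
  refine ⟨δ, hδ, ?_⟩
  have top_eq : z (t + 1) 0 = z t 0 + (M.boldAlpha α *ᵥ shortMemory β l z t) (0, 0) +
      (M.regimeTerm z (t + 1) 0 + (M.c + u (t + 1)) 0) := by
    rw [boldAlpha_mulVec_zero, ← hαβ, h.errorCorrection t]
    simp only [Pi.add_apply, add_assoc]
  have part : z t 0 - max (z t 0) 0 = yNeg z t := by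
    linarith [max_add_min (z t 0) 0]
  rw [state, state, F_mulVec, ← hgap, ← regimeTerm_succ, h.shortMemory_succ hαβ, shockMatrix,
    Matrix.fromRows_mulVec, Matrix.fromRows_mulVec]
  ext (i | _ | i)
  · simp [Matrix.mulVec_add, add_assoc]
  · simp only [Sum.elim_inr, Sum.elim_inl, Pi.add_apply, add_sub_cancel_right, top_eq]
    simp only [Matrix.mulVec, Matrix.of_apply, single_one_dotProduct, Pi.add_apply]
    linarith [part]
  · cases i using Fin.cases with
    | zero => simp
    | succ i => simp [← sub_sub, sub_right_comm _ (_ : ℤ) 1]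

end CompanionForm

end CKSVAR

/-! ### Pathwise bounds for the short-memory components -/

theorem exists_norm_mulVec_le {m n : Type*} [Fintype m] [Fintype n] (A : Matrix m n ℝ) :
    ∃ K : ℝ≥0, ∀ x, ‖A *ᵥ x‖ ≤ K * ‖x‖ :=
  ⟨‖A.mulVecLin.toContinuousLinearMap‖₊, A.mulVecLin.toContinuousLinearMap.le_opNorm⟩

theorem le_div_one_sub_of_le_mul_add {a : ℕ → ℝ} {θ b : ℝ} {n : ℕ} (hθ0 : 0 ≤ θ) (hθ1 : θ < 1)
    (h0 : a 0 ≤ b / (1 - θ)) (hstep : ∀ t < n, a (t + 1) ≤ θ * a t + b) :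
    ∀ t ≤ n, a t ≤ b / (1 - θ) := by
  have hfix : θ * (b / (1 - θ)) + b = b / (1 - θ) := by
    field_simp [(sub_pos.2 hθ1).ne']
    ring
  intro t
  induction t with
  | zero => exact fun _ => h0
  | succ t ih =>
    intro ht
    calc a (t + 1) ≤ θ * a t + b := hstep t ht
      _ ≤ θ * (b / (1 - θ)) + b := by gcongr; exact ih (Nat.le_of_succ_le ht)
      _ = b / (1 - θ) := hfix

namespace CKSVAR

variable {d l r : ℕ} {M : CKSVAR d l} {α β : Matrix (Fin (d + 1)) (Fin r) ℝ}
  {u : ℕ → Fin (d + 1) → ℝ} {z : ℤ → Fin (d + 1) → ℝ} {n : ℕ} {B : ℝ}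

/-- The equilibrium errors, the differences and the negative parts of a path are bounded by `B` up
to time `n`; for the differences and the negative parts this includes the initial values. -/
structure ShortMemoryBound (l : ℕ) (β : Matrix (Fin (d + 1)) (Fin r) ℝ)
    (z : ℤ → Fin (d + 1) → ℝ) (n : ℕ) (B : ℝ) : Prop where
  eqErr : ∀ t : ℕ, t ≤ n → ‖βᵀ *ᵥ z t‖ ≤ B
  diff : ∀ t : ℤ, -(l : ℤ) ≤ t → t ≤ n → ‖z t - z (t - 1)‖ ≤ B
  neg : ∀ t : ℤ, -(l + 1 : ℤ) ≤ t → t ≤ n → |yNeg z t| ≤ B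

/-- The shocks up to time `n` and the short-memory components of the initial values are bounded by
`B`. The bound is at least `1` so that multiples of it also dominate constants. -/
structure InputBound (l : ℕ) (β : Matrix (Fin (d + 1)) (Fin r) ℝ) (u : ℕ → Fin (d + 1) → ℝ)
    (z : ℤ → Fin (d + 1) → ℝ) (n : ℕ) (B : ℝ) : Prop extends ShortMemoryBound l β z 0 B where
  one_le : 1 ≤ B
  shock : ∀ t, 1 ≤ t → t ≤ n → ‖u t‖ ≤ B

theorem ShortMemoryBound.nonneg (h : ShortMemoryBound l β z n B) : 0 ≤ B :=
  (abs_nonneg _).trans (h.neg 0 (by omega) (by omega))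

theorem ShortMemoryBound.mono {B' : ℝ} (h : ShortMemoryBound l β z n B) (hB : B ≤ B') :
    ShortMemoryBound l β z n B' where
  eqErr t ht := (h.eqErr t ht).trans hB
  diff t ht ht' := (h.diff t ht ht').trans hB
  neg t ht ht' := (h.neg t ht ht').trans hB

theorem ShortMemoryBound.norm_state_le (h : ShortMemoryBound l β z n B) {t : ℕ} (ht : t ≤ n) :
    ‖state β l z t‖ ≤ 2 * B := by
  have hB := h.nonneg
  have hB2 : B ≤ 2 * B := by linarith
  rw [pi_norm_le_iff_of_nonneg (by positivity)]
  rintro ((b | ⟨m, a⟩) | _ | i)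
  · exact ((norm_le_pi_norm _ b).trans (h.eqErr t ht)).trans hB2
  · exact ((norm_le_pi_norm _ a).trans (h.diff (t - (m : ℕ)) (by omega) (by omega))).trans hB2
  · have gap_eq : z t 0 - max (z (t - 1) 0) 0 = (z t - z (t - 1)) 0 + yNeg z (t - 1) := by
      rw [Pi.sub_apply]
      linarith [max_add_min (z (t - 1) 0) 0]
    calc ‖z t 0 - max (z (t - 1) 0) 0‖ ≤ ‖(z t - z (t - 1)) 0‖ + ‖yNeg z (t - 1)‖ := by
          rw [gap_eq]
          exact norm_add_le _ _
      _ ≤ B + B := add_le_add ((norm_le_pi_norm _ 0).trans (h.diff t (by omega) (by omega)))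
          (h.neg (t - 1) (by omega) (by omega))
      _ = 2 * B := (two_mul B).symm
  · exact (h.neg (t - 1 - (i : ℕ)) (by omega) (by omega)).trans hB2

theorem ShortMemoryBound.of_norm_state_le (h0 : ShortMemoryBound l β z 0 B)
    (h : ∀ t : ℕ, t ≤ n → ‖state β l z t‖ ≤ B) : ShortMemoryBound l β z n B := by
  have coord_le (t : ℕ) (ht : t ≤ n) (i) : ‖state β l z t i‖ ≤ B :=
    (norm_le_pi_norm _ i).trans (h t ht)
  refine ⟨fun t ht => ?_, fun t ht ht' => ?_, fun t ht ht' => ?_⟩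
  · rw [pi_norm_le_iff_of_nonneg h0.nonneg]
    exact fun b => coord_le t ht (Sum.inl (Sum.inl b))
  · rcases le_or_gt t 0 with htn | htp
    · exact h0.diff t ht htn
    · lift t to ℕ using htp.le
      rw [pi_norm_le_iff_of_nonneg h0.nonneg]
      intro a
      simpa [state, shortMemory] using
        coord_le t (by exact_mod_cast ht') (Sum.inl (Sum.inr (0, a)))
  · rcases le_or_gt t 0 with htn | htp
    · exact h0.neg t ht htn
    · lift t to ℕ using htp.le
      obtain ⟨δ, hδ, hgap⟩ := exists_regime_weight (z (t - 1) 0) (z t 0)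
      calc |yNeg z t| = δ * |z t 0 - max (z (t - 1) 0) 0| := by
            rw [yNeg, hgap, abs_mul, abs_of_nonneg hδ.1]
        _ ≤ |z t 0 - max (z (t - 1) 0) 0| := mul_le_of_le_one_left (abs_nonneg _) hδ.2
        _ ≤ B := coord_le t (by exact_mod_cast ht') (Sum.inr (Sum.inl ()))

theorem seminorm_F_mulVec_le
    {p : Seminorm ℝ ((Fin r ⊕ Fin (l + 1) × Fin (d + 1)) ⊕ (Unit ⊕ Fin (l + 1)) → ℝ)} {θ : ℝ}
    (h0 : ∀ v, p (M.F α β 0 *ᵥ v) ≤ θ * p v) (h1 : ∀ v, p (M.F α β 1 *ᵥ v) ≤ θ * p v) {δ : ℝ}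
    (hδ : δ ∈ Set.Icc (0 : ℝ) 1) (v) : p (M.F α β δ *ᵥ v) ≤ θ * p v := by
  have hδ' : 0 ≤ 1 - δ := sub_nonneg.2 hδ.2
  calc p (M.F α β δ *ᵥ v) ≤ (1 - δ) * p (M.F α β 0 *ᵥ v) + δ * p (M.F α β 1 *ᵥ v) := by
        rw [F_eq_combination, Matrix.add_mulVec, Matrix.smul_mulVec, Matrix.smul_mulVec]
        refine (map_add_le_add p _ _).trans_eq ?_
        rw [map_smul_eq_mul, map_smul_eq_mul, Real.norm_of_nonneg hδ', Real.norm_of_nonneg hδ.1]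
    _ ≤ (1 - δ) * (θ * p v) + δ * (θ * p v) :=
        add_le_add (mul_le_mul_of_nonneg_left (h0 v) hδ') (mul_le_mul_of_nonneg_left (h1 v) hδ.1)
    _ = θ * p v := by ring

theorem InputBound.norm_add_shock_le (h : InputBound l β u z n B) (c : Fin (d + 1) → ℝ) {t : ℕ}
    (ht1 : 1 ≤ t) (htn : t ≤ n) : ‖c + u t‖ ≤ (‖c‖ + 1) * B := calc
  ‖c + u t‖ ≤ ‖c‖ * 1 + B := by
    rw [mul_one]
    exact (norm_add_le _ _).trans (by gcongr; exact h.shock t ht1 htn)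
  _ ≤ ‖c‖ * B + B := by gcongr; exact h.one_le
  _ = (‖c‖ + 1) * B := by ring

theorem exists_norm_state_le (hαβ : M.PiMat .pos = α * βᵀ)
    (hjsr : jointSpectralRadius {M.F α β 0, M.F α β 1} < 1) :
    ∃ C : ℝ≥0, ∀ ⦃u z n B⦄, M.IsPath u z → InputBound l β u z n B →
      ∀ t : ℕ, t ≤ n → ‖state β l z t‖ ≤ C * B := by
  obtain ⟨p, θ, K, hθ, norm_le, le_norm, contract⟩ :=
    exists_contracting_seminorm (Set.toFinite _) hjsr
  obtain ⟨G, hG⟩ := exists_norm_mulVec_le (shockMatrix β l)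
  have hθ' : (θ : ℝ) < 1 := hθ
  refine ⟨K * (K * (2 + G * (‖M.c‖₊ + 1)) / (1 - θ)), fun u z n B hz hB t ht => ?_⟩
  have hB0 : 0 ≤ B := hB.nonneg
  let b : ℝ := K * (2 * B + G * ((‖M.c‖ + 1) * B))
  have start : p (state β l z (0 : ℕ)) ≤ b :=
    (le_norm _).trans <| mul_le_mul_of_nonneg_left
      ((hB.norm_state_le le_rfl).trans (le_add_of_nonneg_right (by positivity))) K.2
  have shock (s : ℕ) (hs : s < n) : p (shockMatrix β l *ᵥ (M.c + u (s + 1))) ≤ b :=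
    (le_norm _).trans <| mul_le_mul_of_nonneg_left
      (((hG _).trans (by gcongr; exact hB.norm_add_shock_le M.c (by omega) hs)).trans
        (le_add_of_nonneg_left (by positivity))) K.2
  have step (s : ℕ) (hs : s < n) :
      p (state β l z (s + 1 : ℕ)) ≤ θ * p (state β l z s) + b := by
    obtain ⟨δ, hδ, hstate⟩ := hz.state_succ hαβ s
    rw [Nat.cast_succ, hstate]
    exact (map_add_le_add p _ _).trans (add_le_add
      (seminorm_F_mulVec_le (contract _ (by simp)) (contract _ (by simp)) hδ _) (shock s hs))
  have hb : b ≤ b / (1 - θ) :=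
    le_div_self ((apply_nonneg p _).trans start) (sub_pos.2 hθ') (sub_le_self 1 θ.2)
  have bound : p (state β l z t) ≤ b / (1 - θ) :=
    le_div_one_sub_of_le_mul_add (a := fun s : ℕ => p (state β l z s)) θ.2 hθ' (start.trans hb)
      step t ht
  calc ‖state β l z t‖ ≤ K * (b / (1 - θ)) :=
        (norm_le _).trans (mul_le_mul_of_nonneg_left bound K.2)
    _ = _ := by
      push_cast [NNReal.coe_sub hθ.le]
      ring

theorem exists_shortMemoryBound (hαβ : M.PiMat .pos = α * βᵀ)
    (hjsr : jointSpectralRadius {M.F α β 0, M.F α β 1} < 1) :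
    ∃ C : ℝ≥0, ∀ ⦃u z n B⦄, M.IsPath u z → InputBound l β u z n B →
      ShortMemoryBound l β z n (C * B) := by
  obtain ⟨C, hC⟩ := exists_norm_state_le hαβ hjsr
  refine ⟨C + 1, fun u z n B hz hB => ?_⟩
  have hB0 : 0 ≤ B := hB.nonneg
  refine .of_norm_state_le (hB.mono (le_mul_of_one_le_left hB0 (by simp))) fun t ht =>
    (hC hz hB t ht).trans ?_
  gcongr
  exact_mod_cast le_add_of_nonneg_right zero_le_one

end CKSVAR

/-! ### The projection on the common trends -/

theorem exists_norm_mulVec_le_mul_norm_mulVec {k m n : Type*} [Fintype k] [Fintype m] [Fintype n]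
    {A : Matrix m n ℝ} {Q : Matrix k n ℝ} (h : ∀ x, A *ᵥ x = 0 → Q *ᵥ x = 0) :
    ∃ K : ℝ≥0, ∀ x, ‖Q *ᵥ x‖ ≤ K * ‖A *ᵥ x‖ := by
  obtain ⟨s, hs⟩ := A.mulVecLin.rangeRestrict.exists_rightInverse_of_surjective
    A.mulVecLin.range_rangeRestrict
  let G := (Q.mulVecLin ∘ₗ s).toContinuousLinearMap
  refine ⟨‖G‖₊, fun x => ?_⟩
  have hsx : A *ᵥ (x - s (A.mulVecLin.rangeRestrict x)) = 0 := by
    rw [Matrix.mulVec_sub, sub_eq_zero]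
    exact congrArg Subtype.val (LinearMap.congr_fun hs (A.mulVecLin.rangeRestrict x)).symm
  have hQ : Q *ᵥ x = G (A.mulVecLin.rangeRestrict x) := by
    rw [← sub_eq_zero, ← h _ hsx, Matrix.mulVec_sub]
    rfl
  rw [hQ]
  exact G.le_opNorm _

theorem mulVec_injective_of_rank_eq_card {K m n : Type*} [Field K] [Fintype n]
    {A : Matrix m n K} (hA : A.rank = Fintype.card n) : Function.Injective A.mulVec := by
  have hker := A.mulVecLin.finrank_range_add_finrank_ker
  rw [← Matrix.rank, hA, Module.finrank_fintype_fun_eq_card, Nat.add_eq_left,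
    Submodule.finrank_eq_zero] at hker
  exact LinearMap.ker_eq_bot.1 hker

theorem IsOrthocomplement.exists_mulVec_eq {m n q : ℕ} {A : Matrix (Fin m) (Fin n) ℝ}
    {B : Matrix (Fin m) (Fin q) ℝ} (h : IsOrthocomplement A B) (hA : A.rank = n)
    {x : Fin m → ℝ} (hx : Aᵀ *ᵥ x = 0) : ∃ w, B *ᵥ w = x := by
  obtain ⟨hnq, hB, hBA⟩ := h
  have hAB : Aᵀ * B = 0 := by simpa using congrArg Matrix.transpose hBA
  have range_le_ker : LinearMap.range B.mulVecLin ≤ LinearMap.ker Aᵀ.mulVecLin := by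
    rintro _ ⟨w, rfl⟩
    rw [LinearMap.mem_ker, Matrix.mulVecLin_apply, Matrix.mulVecLin_apply, Matrix.mulVec_mulVec,
      hAB, Matrix.zero_mulVec]
  have rank_nullity := Aᵀ.mulVecLin.finrank_range_add_finrank_ker
  rw [← Matrix.rank, Matrix.rank_transpose, hA, Module.finrank_fin_fun] at rank_nullity
  have range_eq_ker := Submodule.eq_of_le_of_finrank_eq range_le_ker
    (by rw [← Matrix.rank, hB]; omega)
  exact range_eq_ker.ge hx

namespace CKSVAR

section Projection

variable {d l r q : ℕ} {M : CKSVAR d l} {α β : Matrix (Fin (d + 1)) (Fin r) ℝ}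
  {αp βp : Matrix (Fin (d + 1)) (Fin q) ℝ}

theorem isUnit_det_of_kappa_ne_zero (hκ : M.kappa αp βp 0 ≠ 0) :
    IsUnit (αpᵀ * M.GammaOne .pos * βp).det := by
  by_contra h
  simp [kappa, proj, Matrix.nonsing_inv_apply_not_isUnit _ h] at hκ

theorem proj_mul_gammaOne_mul (hκ : M.kappa αp βp 0 ≠ 0) :
    M.proj αp βp * M.GammaOne .pos * βp = βp := by
  rw [proj, Matrix.mul_assoc, Matrix.mul_assoc, ← Matrix.mul_assoc αpᵀ, Matrix.mul_assoc βp,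
    Matrix.nonsing_inv_mul _ (isUnit_det_of_kappa_ne_zero hκ), Matrix.mul_one]

theorem proj_mulVec_gammaOne_mulVec (hκ : M.kappa αp βp 0 ≠ 0) (hβ : β.rank = r)
    (hβp : IsOrthocomplement β βp) {x : Fin (d + 1) → ℝ} (hx : βᵀ *ᵥ x = 0) :
    M.proj αp βp *ᵥ M.GammaOne .pos *ᵥ x = x := by
  obtain ⟨w, rfl⟩ := hβp.exists_mulVec_eq hβ hx
  rw [Matrix.mulVec_mulVec, Matrix.mulVec_mulVec, proj_mul_gammaOne_mul hκ]

theorem proj_mulVec_piMat_mulVec (hαβ : M.PiMat .pos = α * βᵀ) (hαp : IsOrthocomplement α αp)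
    (v : Fin (d + 1) → ℝ) : M.proj αp βp *ᵥ M.PiMat .pos *ᵥ v = 0 := by
  rw [hαβ, proj, Matrix.mulVec_mulVec, Matrix.mul_assoc, ← Matrix.mul_assoc αpᵀ, hαp.2.2,
    Matrix.zero_mul, Matrix.mul_zero, Matrix.zero_mulVec]

theorem piMat_mulVec_single (M : CKSVAR d l) (s : Regime) :
    M.PiMat s *ᵥ Pi.single 0 1 = M.pi s := by
  ext a
  simp [PiMat, colCons]

theorem proj_mulVec_pi_sub_pi (hαβ : M.PiMat .pos = α * βᵀ) (hαp : IsOrthocomplement α αp) :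
    M.proj αp βp *ᵥ (M.pi .neg - M.pi .pos) = M.kappa αp βp := by
  rw [Matrix.mulVec_sub, ← M.piMat_mulVec_single .pos, proj_mulVec_piMat_mulVec hαβ hαp, sub_zero,
    kappa]

theorem exists_norm_sub_proj_le (hκ : M.kappa αp βp 0 ≠ 0) (hβ : β.rank = r)
    (hβp : IsOrthocomplement β βp) : ∃ C : ℝ≥0, ∀ x : Fin (d + 1) → ℝ,
      ‖x - M.proj αp βp *ᵥ M.GammaOne .pos *ᵥ x‖ ≤ C * ‖βᵀ *ᵥ x‖ := by
  obtain ⟨C, hC⟩ := exists_norm_mulVec_le_mul_norm_mulVec (A := βᵀ)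
    (Q := 1 - M.proj αp βp * M.GammaOne .pos) fun x hx => by
      rw [Matrix.sub_mulVec, Matrix.one_mulVec, ← Matrix.mulVec_mulVec,
        proj_mulVec_gammaOne_mulVec hκ hβ hβp hx, sub_self]
  refine ⟨C, fun x => ?_⟩
  simpa only [Matrix.sub_mulVec, Matrix.one_mulVec, Matrix.mulVec_mulVec] using hC x

end Projection

/-! ### The common trends -/

section Trend

variable {d l r q : ℕ} (M : CKSVAR d l) (αp βp : Matrix (Fin (d + 1)) (Fin q) ℝ)

/-- The common trends `P_{β⊥} (Γ⁺(1) z₀ + ∑_{s ≤ t} u_s)`, the discrete counterpart of `projU`. -/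
def trend (u : ℕ → Fin (d + 1) → ℝ) (z₀ : Fin (d + 1) → ℝ) (t : ℕ) : Fin (d + 1) → ℝ :=
  M.proj αp βp *ᵥ (M.GammaOne .pos *ᵥ z₀ + ∑ s ∈ Finset.Icc 1 t, u s)

/-- The transitory part of the process: a combination of lagged differences and of lagged negative
parts, chosen so that the increments of `Γ⁺(1) z_t + transient z t` are free of lags. -/
def transient (z : ℤ → Fin (d + 1) → ℝ) (t : ℤ) : Fin (d + 1) → ℝ :=
  ∑ m ∈ Finset.range (l + 1), M.Gamma .pos (m + 1) *ᵥ (z t - z (t - (m + 1 : ℕ))) +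
    ∑ i ∈ Finset.Icc 1 (l + 2), (∑ j ∈ Finset.range i, yNeg z (t - j)) • M.phiDiff i

theorem sum_phiDiff : ∑ i ∈ Finset.Icc 1 (l + 2), M.phiDiff i = M.pi .neg - M.pi .pos := by
  simp [phiDiff, pi, Finset.sum_sub_distrib]

theorem gammaOne_mulVec (s : Regime) (x : Fin (d + 1) → ℝ) :
    M.GammaOne s *ᵥ x = x - ∑ m ∈ Finset.range (l + 1), M.Gamma s (m + 1) *ᵥ x := by
  rw [GammaOne, Matrix.sub_mulVec, Matrix.one_mulVec, ← Finset.Ico_add_one_right_eq_Icc,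
    Finset.sum_Ico_eq_sum_range, Matrix.sum_mulVec]
  simp only [Nat.add_sub_cancel, add_comm 1]

theorem gammaOne_mulVec_add_transient (z : ℤ → Fin (d + 1) → ℝ) (t : ℤ) :
    M.GammaOne .pos *ᵥ z t + M.transient z t =
      z t - ∑ m ∈ Finset.range (l + 1), M.Gamma .pos (m + 1) *ᵥ z (t - (m + 1 : ℕ)) +
        ∑ i ∈ Finset.Icc 1 (l + 2), (∑ j ∈ Finset.range i, yNeg z (t - j)) • M.phiDiff i := by
  simp only [gammaOne_mulVec, transient, Matrix.mulVec_sub, Finset.sum_sub_distrib]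
  abel

theorem sum_smul_phiDiff_succ (z : ℤ → Fin (d + 1) → ℝ) (t : ℤ) :
    ∑ i ∈ Finset.Icc 1 (l + 2), (∑ j ∈ Finset.range i, yNeg z (t + 1 - j)) • M.phiDiff i +
        M.regimeTerm z (t + 1) =
      ∑ i ∈ Finset.Icc 1 (l + 2), (∑ j ∈ Finset.range i, yNeg z (t - j)) • M.phiDiff i +
        yNeg z (t + 1) • (M.pi .neg - M.pi .pos) := by
  rw [← sum_phiDiff, Finset.smul_sum, regimeTerm, ← Finset.sum_add_distrib,
    ← Finset.sum_add_distrib]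
  refine Finset.sum_congr rfl fun i _ => ?_
  have telescope := sum_range_lag_sub (yNeg z) (t + 1) i
  rw [Finset.sum_sub_distrib] at telescope
  rw [← add_smul, ← add_smul]
  congr 1
  have shift (j : ℕ) : t + 1 - j - 1 = t - j := by ring
  simp only [shift] at telescope
  linarith

variable {M αp βp}
variable {α β : Matrix (Fin (d + 1)) (Fin r) ℝ} {u : ℕ → Fin (d + 1) → ℝ}
  {z : ℤ → Fin (d + 1) → ℝ}

theorem IsPath.gammaOne_mulVec_add_transient_succ (h : M.IsPath u z) (t : ℕ) :
    M.GammaOne .pos *ᵥ z (t + 1) + M.transient z (t + 1) =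
      M.GammaOne .pos *ᵥ z t + M.transient z t + M.PiMat .pos *ᵥ z t + (M.c + u (t + 1)) +
        yNeg z (t + 1) • (M.pi .neg - M.pi .pos) := by
  have lag (m : ℕ) : (t : ℤ) + 1 - (m + 1 : ℕ) = t - m := by push_cast; ring
  have lag' (m : ℕ) : (t : ℤ) - (m + 1 : ℕ) = t - m - 1 := by push_cast; ring
  rw [gammaOne_mulVec_add_transient, gammaOne_mulVec_add_transient,
    eq_sub_of_add_eq (M.sum_smul_phiDiff_succ z t), h.errorCorrection t]
  simp only [lag, lag', Matrix.mulVec_sub, Finset.sum_sub_distrib]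
  abel

theorem trend_succ (z₀ : Fin (d + 1) → ℝ) (t : ℕ) :
    M.trend αp βp u z₀ (t + 1) = M.trend αp βp u z₀ t + M.proj αp βp *ᵥ u (t + 1) := by
  rw [trend, Finset.sum_Icc_succ_top (by omega), ← add_assoc, Matrix.mulVec_add, trend]

theorem IsPath.proj_mulVec_eq (h : M.IsPath u z) (hαβ : M.PiMat .pos = α * βᵀ)
    (hαp : IsOrthocomplement α αp) (hc : ∃ v, M.PiMat .pos *ᵥ v = M.c) (t : ℕ) :
    M.proj αp βp *ᵥ (M.GammaOne .pos *ᵥ z t + M.transient z t) =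
      M.trend αp βp u (z 0) t + M.proj αp βp *ᵥ M.transient z 0 +
        (∑ s ∈ Finset.Icc 1 t, yNeg z s) • M.kappa αp βp := by
  induction t with
  | zero => simp [trend, Matrix.mulVec_add]
  | succ t ih =>
    obtain ⟨v, hv⟩ := hc
    rw [Nat.cast_succ, h.gammaOne_mulVec_add_transient_succ t, Matrix.mulVec_add,
      Matrix.mulVec_add, Matrix.mulVec_add, ih, ← hv, Matrix.mulVec_add,
      proj_mulVec_piMat_mulVec hαβ hαp, proj_mulVec_piMat_mulVec hαβ hαp, Matrix.mulVec_smul,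
      proj_mulVec_pi_sub_pi hαβ hαp, trend_succ, Finset.sum_Icc_succ_top (by omega), add_smul,
      Nat.cast_succ]
    abel

theorem ShortMemoryBound.norm_sub_le {n : ℕ} {B : ℝ} (h : ShortMemoryBound l β z n B) {t k : ℕ}
    (ht : t ≤ n) (hk : k ≤ l + 1) : ‖z t - z (t - k)‖ ≤ (l + 1) * B := calc
  ‖z t - z (t - k)‖ ≤ ∑ _j ∈ Finset.range k, B := by
    rw [← sum_range_lag_sub]
    refine norm_sum_le_of_le _ fun j hj => h.diff _ ?_ ?_ <;>
      have := Finset.mem_range.1 hj <;> omega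
  _ = k * B := by simp
  _ ≤ (l + 1) * B := mul_le_mul_of_nonneg_right (by exact_mod_cast hk) h.nonneg

theorem ShortMemoryBound.norm_sum_yNeg_le {n : ℕ} {B : ℝ} (h : ShortMemoryBound l β z n B)
    {t i : ℕ} (ht : t ≤ n) (hi : i ≤ l + 2) :
    ‖∑ j ∈ Finset.range i, yNeg z (t - j)‖ ≤ (l + 2) * B := calc
  ‖∑ j ∈ Finset.range i, yNeg z (t - j)‖ ≤ ∑ _j ∈ Finset.range i, B := by
    refine norm_sum_le_of_le _ fun j hj => h.neg _ ?_ ?_ <;>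
      have := Finset.mem_range.1 hj <;> omega
  _ = i * B := by simp
  _ ≤ (l + 2) * B := mul_le_mul_of_nonneg_right (by exact_mod_cast hi) h.nonneg

theorem exists_norm_transient_le (M : CKSVAR d l) (β : Matrix (Fin (d + 1)) (Fin r) ℝ) :
    ∃ C : ℝ≥0, ∀ ⦃z n B⦄, ShortMemoryBound l β z n B →
      ∀ t : ℕ, t ≤ n → ‖M.transient z t‖ ≤ C * B := by
  choose K hK using fun m : ℕ => exists_norm_mulVec_le (M.Gamma .pos (m + 1))
  refine ⟨∑ m ∈ Finset.range (l + 1), K m * (l + 1) +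
    ∑ i ∈ Finset.Icc 1 (l + 2), (l + 2) * ‖M.phiDiff i‖₊, fun z n B h t ht => ?_⟩
  push_cast
  rw [add_mul, Finset.sum_mul, Finset.sum_mul]
  refine norm_add_le_of_le (norm_sum_le_of_le _ fun m hm => ?_) (norm_sum_le_of_le _ fun i hi => ?_)
  · rw [mul_assoc]
    exact (hK m _).trans (mul_le_mul_of_nonneg_left
      (h.norm_sub_le ht (Finset.mem_range.1 hm)) (K m).2)
  · rw [norm_smul, mul_right_comm]
    exact mul_le_mul_of_nonneg_right (h.norm_sum_yNeg_le ht (Finset.mem_Icc.1 hi).2)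
      (norm_nonneg _)

theorem exists_norm_sub_trend_le (hαβ : M.PiMat .pos = α * βᵀ) (hβ : β.rank = r)
    (hαp : IsOrthocomplement α αp) (hβp : IsOrthocomplement β βp) (hκ : M.kappa αp βp 0 ≠ 0)
    (hc : ∃ v, M.PiMat .pos *ᵥ v = M.c) :
    ∃ C : ℝ≥0, ∀ ⦃u z n B⦄, M.IsPath u z → ShortMemoryBound l β z n B → ∀ t : ℕ, t ≤ n →
      ‖z t - (M.trend αp βp u (z 0) t +
        (∑ s ∈ Finset.Icc 1 t, yNeg z s) • M.kappa αp βp)‖ ≤ C * B := by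
  obtain ⟨C₁, eqErr_le⟩ := exists_norm_sub_proj_le (αp := αp) hκ hβ hβp
  obtain ⟨C₂, transient_le⟩ := exists_norm_transient_le M β
  obtain ⟨C₃, proj_le⟩ := exists_norm_mulVec_le (M.proj αp βp)
  refine ⟨C₁ + C₃ * (C₂ + C₂), fun u z n B hz hB t ht => ?_⟩
  have decomposition : z t - (M.trend αp βp u (z 0) t +
      (∑ s ∈ Finset.Icc 1 t, yNeg z s) • M.kappa αp βp) =
      (z t - M.proj αp βp *ᵥ M.GammaOne .pos *ᵥ z t) +
        M.proj αp βp *ᵥ (M.transient z (0 : ℕ) - M.transient z t) := by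
    have hproj := hz.proj_mulVec_eq (βp := βp) hαβ hαp hc t
    rw [Matrix.mulVec_add, ← eq_sub_iff_add_eq] at hproj
    rw [hproj, Matrix.mulVec_sub, Nat.cast_zero]
    abel
  calc _ ≤ C₁ * B + C₃ * (C₂ * B + C₂ * B) := by
        rw [decomposition]
        refine norm_add_le_of_le ((eqErr_le _).trans ?_) ((proj_le _).trans ?_)
        · exact mul_le_mul_of_nonneg_left (hB.eqErr t ht) C₁.2
        · exact mul_le_mul_of_nonneg_left (norm_sub_le_of_le (transient_le hB 0 (Nat.zero_le n))
            (transient_le hB t ht)) C₃.2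
    _ = _ := by
      push_cast
      ring

end Trend

end CKSVAR

/-! ### The discrete Skorokhod problem -/

/-- The regulator `max_{s ≤ t} [-x s]₊` of a sequence `x`. -/
def discreteRegulator (x : ℕ → ℝ) (t : ℕ) : ℝ :=
  (Finset.range (t + 1)).sup' Finset.nonempty_range_add_one fun s => max (-x s) 0

theorem discreteRegulator_succ (x : ℕ → ℝ) (t : ℕ) :
    discreteRegulator x (t + 1) = max (discreteRegulator x t) (max (-x (t + 1)) 0) := by
  simp only [discreteRegulator, Finset.range_add_one (n := t + 1)]
  rw [Finset.sup'_insert, max_comm]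

theorem discreteRegulator_nonneg (x : ℕ → ℝ) (t : ℕ) : 0 ≤ discreteRegulator x t :=
  (le_max_right _ _).trans
    (Finset.le_sup' (fun s => max (-x s) 0) (Finset.mem_range.2 t.lt_add_one))

/- `ℓ` increases only when `y < 0`, hence only when `y ≈ 0`, so `ℓ ≈ -v` at its times of increase;
in between, `v + ℓ ≈ y ≥ -B`. -/
theorem abs_sub_discreteRegulator_le {y v ℓ : ℕ → ℝ} {B : ℝ} {n : ℕ} (h0 : ℓ 0 = 0)
    (hmono : Monotone ℓ) (hflat : ∀ t, 0 ≤ y (t + 1) → ℓ (t + 1) = ℓ t)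
    (hy : ∀ t ≤ n, |y t - (v t + ℓ t)| ≤ B) (hneg : ∀ t ≤ n, -B ≤ y t) {t : ℕ} (ht : t ≤ n) :
    |ℓ t - discreteRegulator v t| ≤ 2 * B := by
  have hB : 0 ≤ B := (abs_nonneg _).trans (hy t ht)
  have regulator_le : discreteRegulator v t ≤ ℓ t + 2 * B := by
    refine Finset.sup'_le _ _ fun s hs => ?_
    have hst : s ≤ t := Finset.mem_range_succ_iff.1 hs
    have hys := abs_le.1 (hy s (hst.trans ht))
    refine max_le ?_ ?_
    · linarith [hneg s (hst.trans ht), hmono hst]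
    · linarith [h0 ▸ hmono t.zero_le]
  have le_regulator : ℓ t ≤ discreteRegulator v t + B := by
    clear regulator_le
    induction t with
    | zero => linarith [discreteRegulator_nonneg v 0]
    | succ t ih =>
      rw [discreteRegulator_succ]
      rcases le_or_gt 0 (y (t + 1)) with hpos | hneg
      · rw [hflat t hpos]
        linarith [ih (Nat.le_of_succ_le ht),
          le_max_left (discreteRegulator v t) (max (-v (t + 1)) 0)]
      · linarith [(abs_le.1 (hy (t + 1) ht)).1, le_max_left (-v (t + 1)) 0,
          le_max_right (discreteRegulator v t) (max (-v (t + 1)) 0)]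
  rw [abs_le]
  constructor <;> linarith

namespace CKSVAR

variable {d l r q : ℕ} {M : CKSVAR d l} {α β : Matrix (Fin (d + 1)) (Fin r) ℝ}
  {αp βp : Matrix (Fin (d + 1)) (Fin q) ℝ}

theorem exists_norm_sub_regulated_trend_le (hαβ : M.PiMat .pos = α * βᵀ) (hβ : β.rank = r)
    (hαp : IsOrthocomplement α αp) (hβp : IsOrthocomplement β βp) (hκ : M.kappa αp βp 0 < 0)
    (hc : ∃ v, M.PiMat .pos *ᵥ v = M.c) :
    ∃ C : ℝ≥0, ∀ ⦃u z n B⦄, M.IsPath u z → ShortMemoryBound l β z n B → ∀ t : ℕ, t ≤ n →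
      ‖z t - (M.trend αp βp u (z 0) t + ((M.kappa αp βp 0)⁻¹ *
        discreteRegulator (fun s => M.trend αp βp u (z 0) s 0) t) • M.kappa αp βp)‖ ≤ C * B := by
  obtain ⟨C, sub_trend_le⟩ := exists_norm_sub_trend_le hαβ hβ hαp hβp hκ.ne hc
  let κ := M.kappa αp βp
  refine ⟨C + ‖(κ 0)⁻¹ • κ‖₊ * (2 * (C + 1)), fun u z n B hz hB t ht => ?_⟩
  have hB0 := hB.nonneg
  let v := M.trend αp βp u (z 0)
  let L : ℕ → ℝ := fun t => ∑ s ∈ Finset.Icc 1 t, yNeg z s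
  have L_succ (t : ℕ) : L (t + 1) = L t + yNeg z (t + 1 : ℕ) :=
    Finset.sum_Icc_succ_top (by omega) _
  have skorokhod : |L t * κ 0 - discreteRegulator (fun s => v s 0) t| ≤ 2 * ((C + 1) * B) := by
    refine abs_sub_discreteRegulator_le (y := fun t => z t 0) (ℓ := fun t => L t * κ 0)
      (by simp [L]) (monotone_nat_of_le_succ fun t => ?_) (fun t hpos => ?_)
      (fun t ht => ?_) (fun t ht => ?_) ht
    · exact mul_le_mul_of_nonpos_right
        ((L_succ t).trans_le (add_le_of_nonpos_right (min_le_right _ _))) hκ.le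
    · rw [L_succ, yNeg, min_eq_right hpos, add_zero]
    · exact (norm_le_pi_norm _ 0).trans ((sub_trend_le hz hB t ht).trans (by linarith))
    · have hCB : 0 ≤ C * B := by positivity
      linarith [(abs_le.1 (hB.neg t (by omega) (by exact_mod_cast ht))).1, min_le_left (z t 0) 0]
  have split : z t - (v t + ((κ 0)⁻¹ * discreteRegulator (fun s => v s 0) t) • κ) =
      (z t - (v t + L t • κ)) +
        (L t * κ 0 - discreteRegulator (fun s => v s 0) t) • (κ 0)⁻¹ • κ := by
    have hL : L t • κ = (L t * κ 0) • (κ 0)⁻¹ • κ := by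
      rw [smul_smul, mul_inv_cancel_right₀ hκ.ne]
    rw [hL, mul_comm, mul_smul, sub_smul]
    abel
  calc _ ≤ C * B + 2 * ((C + 1) * B) * ‖(κ 0)⁻¹ • κ‖ := by
        rw [split]
        refine norm_add_le_of_le (sub_trend_le hz hB t ht) ?_
        rw [norm_smul]
        exact mul_le_mul_of_nonneg_right skorokhod (norm_nonneg _)
    _ = _ := by
      push_cast
      ring

end CKSVAR

/-! ### Cadlag functions -/

section Cadlag

variable {E F : Type*}

theorem IsCadlag.comp [TopologicalSpace E] [TopologicalSpace F] {f : I → E} (hf : IsCadlag f)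
    {g : E → F} (hg : Continuous g) : IsCadlag fun t => g (f t) := by
  intro t
  obtain ⟨hright, l, hleft⟩ := hf t
  exact ⟨hg.continuousAt.comp_continuousWithinAt hright, g l, (hg.tendsto l).comp hleft⟩

theorem IsCadlag.prodMk [TopologicalSpace E] [TopologicalSpace F] {f : I → E} {g : I → F}
    (hf : IsCadlag f) (hg : IsCadlag g) : IsCadlag fun t => (f t, g t) := by
  intro t
  obtain ⟨hf_right, l, hf_left⟩ := hf t
  obtain ⟨hg_right, m, hg_left⟩ := hg t
  exact ⟨hf_right.prodMk hg_right, (l, m), hf_left.prodMk_nhds hg_left⟩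

theorem IsCadlag.isBounded_range [PseudoMetricSpace E] {f : I → E} (hf : IsCadlag f) :
    Bornology.IsBounded (Set.range f) := by
  rw [← Set.image_univ]
  refine isCompact_univ.induction_on (p := fun s => Bornology.IsBounded (f '' s)) (by simp)
    (fun s t hst ht => ht.subset (Set.image_mono hst))
    (fun s t hs ht => by rw [Set.image_union]; exact hs.union ht) fun t _ => ?_
  obtain ⟨hright, l, hleft⟩ := hf t
  obtain ⟨A, hA, hAb⟩ := Metric.exists_isBounded_image_of_tendsto hright
  obtain ⟨B, hB, hBb⟩ := Metric.exists_isBounded_image_of_tendsto hleft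
  refine ⟨B ∪ A, ?_, by rw [Set.image_union]; exact hBb.union hAb⟩
  rw [nhdsWithin_univ, ← nhdsLT_sup_nhdsGE]
  exact union_mem_sup hB hA

theorem isCadlag_step [TopologicalSpace E] (x : ℕ → E) (n : ℕ) :
    IsCadlag fun t : I => x ⌊n * (t : ℝ)⌋₊ := by
  rcases n.eq_zero_or_pos with rfl | hn
  · simp only [Nat.cast_zero, zero_mul, Nat.floor_zero]
    exact fun t => ⟨continuousWithinAt_const, x 0, tendsto_const_nhds⟩
  have hcont : Continuous fun s : I => (n : ℝ) * s := by fun_prop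
  have hmono : StrictMono fun s : I => (n : ℝ) * s := fun s t hst => by
    have hst' : (s : ℝ) < t := hst
    dsimp only
    gcongr
  simp only [← Int.floor_toNat]
  intro t
  have hright : Tendsto (fun s : I => (n : ℝ) * s) (𝓝[≥] t) (𝓝[≥] (n * (t : ℝ))) :=
    tendsto_nhdsWithin_iff.2 ⟨hcont.continuousAt.tendsto.mono_left nhdsWithin_le_nhds,
      eventually_nhdsWithin_of_forall fun s hs => hmono.monotone hs⟩
  have hleft : Tendsto (fun s : I => (n : ℝ) * s) (𝓝[<] t) (𝓝[<] (n * (t : ℝ))) :=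
    tendsto_nhdsWithin_iff.2 ⟨hcont.continuousAt.tendsto.mono_left nhdsWithin_le_nhds,
      eventually_nhdsWithin_of_forall fun s hs => hmono hs⟩
  have hx (m : ℤ) : Tendsto (fun j : ℤ => x j.toNat) (pure m) (𝓝 (x m.toNat)) :=
    (tendsto_pure_pure _ _).mono_right (pure_le_nhds _)
  exact ⟨(hx _).comp ((tendsto_floor_right_pure_floor _).comp hright),
    _, (hx _).comp ((tendsto_floor_left_pure_ceil_sub_one _).comp hleft)⟩

end Cadlag

/-! ### The regulator -/

section Regulator

variable {w w' : I → ℝ} {s t : I} {a ε : ℝ}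

theorem le_regulator (hw : BddBelow (Set.range w)) (hst : s ≤ t) :
    max (-w s) 0 ≤ regulator w t := by
  obtain ⟨b, hb⟩ := hw
  have hbdd : BddAbove (Set.range fun s : Set.Iic t => max (-w s) 0) := by
    refine ⟨max (-b) 0, ?_⟩
    rintro _ ⟨s, rfl⟩
    exact max_le_max_right _ (neg_le_neg (hb ⟨s, rfl⟩))
  exact le_ciSup hbdd (⟨s, hst⟩ : Set.Iic t)

theorem regulator_le (h : ∀ s ≤ t, max (-w s) 0 ≤ a) : regulator w t ≤ a :=
  haveI : Nonempty (Set.Iic t) := ⟨⟨t, Set.self_mem_Iic⟩⟩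
  ciSup_le fun s => h s s.2

theorem regulator_mono (hw : BddBelow (Set.range w)) : Monotone (regulator w) :=
  fun _ _ hst => regulator_le fun _ hs => le_regulator hw (hs.trans hst)

theorem regulator_le_add (hw' : BddBelow (Set.range w')) (h : ∀ s, |w s - w' s| ≤ ε) (t : I) :
    regulator w t ≤ regulator w' t + ε := by
  refine regulator_le fun s hs => ?_
  have hle := max_le_iff.1 (le_regulator hw' hs)
  have habs := abs_le.1 (h s)
  exact max_le (by linarith) (by linarith)

theorem abs_regulator_sub_le (hw : BddBelow (Set.range w)) (hw' : BddBelow (Set.range w'))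
    (h : ∀ s, |w s - w' s| ≤ ε) (t : I) : |regulator w t - regulator w' t| ≤ ε :=
  abs_sub_le_iff.2 ⟨by linarith [regulator_le_add hw' h t],
    by linarith [regulator_le_add hw (fun s => abs_sub_comm (w s) _ ▸ h s) t]⟩

theorem regulator_const_mul (ha : 0 ≤ a) (w : I → ℝ) (t : I) :
    regulator (fun s => a * w s) t = a * regulator w t := by
  simp only [regulator, Real.mul_iSup_of_nonneg ha, mul_max_of_nonneg _ _ ha, mul_zero, mul_neg]

theorem continuousWithinAt_regulator (hw : BddBelow (Set.range w))
    (ht : ContinuousWithinAt w (Set.Ici t) t) :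
    ContinuousWithinAt (regulator w) (Set.Ici t) t := by
  refine tendsto_order.2 ⟨fun a ha => ?_, fun a ha => ?_⟩
  · filter_upwards [self_mem_nhdsWithin] with s hs
    exact ha.trans_le (regulator_mono hw hs)
  · obtain ⟨b, hb, hba⟩ := exists_between ha
    have hwb : ∀ᶠ s in 𝓝[≥] t, -w s < b :=
      ht.neg.eventually_lt_const ((le_max_left _ _).trans_lt ((le_regulator hw le_rfl).trans_lt hb))
    have hIcc : Tendsto (fun s => Set.Icc t s) (𝓝[≥] t) (𝓝[≥] t).smallSets :=
      (tendsto_const_pure.mono_right (pure_le_nhdsWithin Set.self_mem_Ici)).Icc tendsto_id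
    filter_upwards [tendsto_smallSets_iff.1 hIcc _ hwb] with s hs
    refine (regulator_le fun x hx => ?_).trans_lt hba
    rcases le_total x t with hxt | htx
    · exact (le_regulator hw hxt).trans hb.le
    · have hb0 : 0 ≤ b := (le_max_right _ _).trans ((le_regulator hw (le_refl t)).trans hb.le)
      exact max_le (le_of_lt (hs ⟨htx, hx⟩)) hb0

theorem IsCadlag.regulator (hw : IsCadlag w) : IsCadlag (regulator w) := fun t =>
  have hbdd := hw.isBounded_range.bddBelow
  ⟨continuousWithinAt_regulator hbdd (hw t).1, _, (regulator_mono hbdd).tendsto_nhdsLT t⟩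

theorem regulator_step (x : ℕ → ℝ) (n : ℕ) (t : I) :
    regulator (fun s => x ⌊n * (s : ℝ)⌋₊) t = discreteRegulator x ⌊n * (t : ℝ)⌋₊ := by
  refine le_antisymm (regulator_le fun s hs => ?_) (Finset.sup'_le _ _ fun m hm => ?_)
  · refine Finset.le_sup' (fun m => max (-x m) 0) (Finset.mem_range_succ_iff.2 ?_)
    exact Nat.floor_le_floor (mul_le_mul_of_nonneg_left hs n.cast_nonneg)
  · have hgrid : ∃ s ≤ t, ⌊n * (s : ℝ)⌋₊ = m := by
      have hmt : (m : ℝ) ≤ n * t :=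
        (Nat.le_floor_iff (mul_nonneg n.cast_nonneg t.2.1)).1 (Finset.mem_range_succ_iff.1 hm)
      rcases n.eq_zero_or_pos with rfl | hn
      · exact ⟨t, le_rfl, by simpa [eq_comm] using hmt⟩
      have hn' : (0 : ℝ) < n := by exact_mod_cast hn
      have hle : (m : ℝ) / n ≤ t := (div_le_iff₀' hn').2 hmt
      exact ⟨⟨m / n, by positivity, hle.trans t.2.2⟩, hle, by
        simp only [mul_div_cancel₀ _ hn'.ne', Nat.floor_natCast]⟩
    obtain ⟨s, hst, rfl⟩ := hgrid
    exact le_regulator (isCadlag_step x n).isBounded_range.bddBelow hst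

end Regulator

/-! ### Regulated vector-valued paths -/

section Regulate

variable {E : Type*} [NormedAddCommGroup E] [NormedSpace ℝ E] (ℓ : E →L[ℝ] ℝ) (k : E)
  {w w' : I → E} {ε : ℝ}

/-- The path `w`, pushed in the direction `k` by the regulator of its coordinate `ℓ`. -/
def regulate (w : I → E) (t : I) : E := w t + regulator (fun s => ℓ (w s)) t • k

theorem regulate_const_smul {a : ℝ} (ha : 0 ≤ a) (w : I → E) (t : I) :
    regulate ℓ k (fun s => a • w s) t = a • regulate ℓ k w t := by
  simp only [regulate, map_smul, smul_eq_mul, regulator_const_mul ha, smul_add, mul_smul]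

theorem IsCadlag.regulate (hw : IsCadlag w) : IsCadlag (regulate ℓ k w) :=
  (hw.prodMk (hw.comp ℓ.continuous).regulator).comp (g := fun x => x.1 + x.2 • k) (by fun_prop)

theorem norm_regulate_sub_le (hw : IsCadlag w) (hw' : IsCadlag w') (h : ∀ s, ‖w s - w' s‖ ≤ ε)
    (t : I) : ‖regulate ℓ k w t - regulate ℓ k w' t‖ ≤ (1 + ‖ℓ‖ * ‖k‖) * ε := by
  have hreg : |regulator (fun s => ℓ (w s)) t - regulator (fun s => ℓ (w' s)) t| ≤ ‖ℓ‖ * ε :=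
    abs_regulator_sub_le (hw.comp ℓ.continuous).isBounded_range.bddBelow
      (hw'.comp ℓ.continuous).isBounded_range.bddBelow
      (fun s => by rw [← map_sub]; exact ℓ.le_opNorm_of_le (h s)) t
  calc ‖regulate ℓ k w t - regulate ℓ k w' t‖
      = ‖(w t - w' t) +
          (regulator (fun s => ℓ (w s)) t - regulator (fun s => ℓ (w' s)) t) • k‖ := by
        rw [regulate, regulate, add_sub_add_comm, sub_smul]
    _ ≤ ε + ‖ℓ‖ * ε * ‖k‖ := by
        refine (norm_add_le _ _).trans (add_le_add (h t) ?_)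
        rw [norm_smul]
        gcongr
        exact hreg
    _ = (1 + ‖ℓ‖ * ‖k‖) * ε := by ring

end Regulate

/-! ### Maps into the space of cadlag functions -/

namespace CadlagSpace

/-- A cadlag function as an element of `CadlagSpace`. -/
def mk {E : Type*} [EMetricSpace E] (f : I → E) (hf : IsCadlag f) : CadlagSpace E :=
  ⟨UniformFun.ofFun f, hf⟩

theorem isCadlag_path {E : Type*} [EMetricSpace E] (f : CadlagSpace E) : IsCadlag f.path := f.2

theorem edist_le_iff {E : Type*} [EMetricSpace E] {f g : CadlagSpace E} {a : ℝ≥0∞} :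
    edist f g ≤ a ↔ ∀ t, edist (f.path t) (g.path t) ≤ a := iSup_le_iff

variable {E F : Type*} [NormedAddCommGroup E] [NormedAddCommGroup F]

theorem edist_le_ofReal_iff {f g : CadlagSpace E} {ε : ℝ} (hε : 0 ≤ ε) :
    edist f g ≤ ENNReal.ofReal ε ↔ ∀ t, ‖f.path t - g.path t‖ ≤ ε := by
  simp only [edist_le_iff, edist_dist, ENNReal.ofReal_le_ofReal_iff hε, dist_eq_norm]

theorem edist_ne_top (f g : CadlagSpace E) : edist f g ≠ ⊤ := by
  obtain ⟨C, hC⟩ := ((f.isCadlag_path.prodMk g.isCadlag_path).comp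
    continuous_sub).isBounded_range.exists_norm_le
  have hC' (t) : ‖f.path t - g.path t‖ ≤ C := hC _ ⟨t, rfl⟩
  exact ne_top_of_le_ne_top ENNReal.ofReal_ne_top
    ((edist_le_ofReal_iff ((norm_nonneg _).trans (hC' 0))).2 hC')

theorem lipschitzWith_of_norm_path_sub_le {Φ : CadlagSpace E → CadlagSpace F} {K : ℝ≥0}
    (h : ∀ f g ε, (∀ t, ‖f.path t - g.path t‖ ≤ ε) →
      ∀ t, ‖(Φ f).path t - (Φ g).path t‖ ≤ K * ε) : LipschitzWith K Φ := by
  intro f g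
  rw [← ENNReal.ofReal_toReal (edist_ne_top f g), ← ENNReal.ofReal_coe_nnreal,
    ← ENNReal.ofReal_mul K.coe_nonneg, edist_le_ofReal_iff (by positivity)]
  refine h f g _ ((edist_le_ofReal_iff ENNReal.toReal_nonneg).1 ?_)
  rw [ENNReal.ofReal_toReal (edist_ne_top f g)]

end CadlagSpace

theorem floor_mul_le (n : ℕ) (t : I) : ⌊n * (t : ℝ)⌋₊ ≤ n :=
  Nat.floor_le_of_le (mul_le_of_le_one_right n.cast_nonneg t.2.2)

section StepFunction

variable {E : Type*} [EMetricSpace E]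

/-- The step function with given values on the grid of mesh `1 / n`. -/
def stepFun (n : ℕ) (x : Fin (n + 1) → E) : CadlagSpace E :=
  CadlagSpace.mk (fun t : I => x ⟨⌊n * (t : ℝ)⌋₊, Nat.lt_succ_of_le (floor_mul_le n t)⟩) <| by
    have h := isCadlag_step (fun m => x (Fin.ofNat (n + 1) m)) n
    convert h using 3 with t
    exact Fin.ext (Nat.mod_eq_of_lt (Nat.lt_succ_of_le (floor_mul_le n t))).symm

theorem continuous_stepFun (n : ℕ) : Continuous (stepFun (E := E) n) := by
  refine LipschitzWith.continuous (K := 1) fun x y => ?_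
  rw [ENNReal.coe_one, one_mul, CadlagSpace.edist_le_iff]
  exact fun t => edist_le_pi_edist x y _

end StepFunction

/-! ### The limit of the rescaled paths -/

/-- `act A` as a continuous linear map. -/
def actL {m n : Type*} [Fintype m] [Fintype n] [DecidableEq n] (A : Matrix m n ℝ) :
    EuclideanSpace ℝ n →L[ℝ] EuclideanSpace ℝ m :=
  LinearMap.toContinuousLinearMap (Matrix.toLpLin 2 2 A)

theorem act_eq_actL {m n : Type*} [Fintype m] [Fintype n] [DecidableEq n] (A : Matrix m n ℝ)
    (v : EuclideanSpace ℝ n) : act A v = actL A v := rfl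

theorem exists_norm_toLp_le (n : Type*) [Fintype n] :
    ∃ K : ℝ≥0, ∀ x : n → ℝ, ‖(WithLp.toLp 2 x : EuclideanSpace ℝ n)‖ ≤ K * ‖x‖ := by
  let e : (n → ℝ) →L[ℝ] EuclideanSpace ℝ n :=
    (PiLp.continuousLinearEquiv 2 ℝ fun _ : n => ℝ).symm.toContinuousLinearMap
  exact ⟨‖e‖₊, e.le_opNorm⟩

namespace CKSVAR

variable {d l : ℕ} {M : CKSVAR d l} {r q : ℕ} {α β : Matrix (Fin (d + 1)) (Fin r) ℝ}
  {αp βp : Matrix (Fin (d + 1)) (Fin q) ℝ}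

section TrendPath

variable (M αp βp)

/-- The common trend `P_{β⊥} (Γ⁺(1) Z + w)` started from `Z` and driven by the path `w`. -/
def trendPath (Z : EuclideanSpace ℝ (Fin (d + 1))) (w : I → EuclideanSpace ℝ (Fin (d + 1)))
    (t : I) : EuclideanSpace ℝ (Fin (d + 1)) :=
  actL (M.proj αp βp) (actL (M.GammaOne .pos) Z + w t)

/-- The common trend `trendPath M αp βp Z w`, pushed along `κ` so as to keep its first coordinate
nonnegative. -/
def regulatedTrend (Z : EuclideanSpace ℝ (Fin (d + 1))) (w : I → EuclideanSpace ℝ (Fin (d + 1))) :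
    I → EuclideanSpace ℝ (Fin (d + 1)) :=
  regulate (EuclideanSpace.proj 0) ((M.kappa αp βp 0)⁻¹ • WithLp.toLp 2 (M.kappa αp βp))
    (M.trendPath αp βp Z w)

theorem limitPath_eq_regulatedTrend {Ω' : Type*} (Z₀ : EuclideanSpace ℝ (Fin (d + 1)))
    (U : I → Ω' → EuclideanSpace ℝ (Fin (d + 1))) (t : I) (ω : Ω') :
    M.limitPath αp βp Z₀ U t ω = M.regulatedTrend αp βp Z₀ (fun s => U s ω) t := by
  rw [limitPath, mul_comm, mul_smul]
  rfl

theorem isCadlag_trendPath (Z : EuclideanSpace ℝ (Fin (d + 1)))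
    {w : I → EuclideanSpace ℝ (Fin (d + 1))} (hw : IsCadlag w) :
    IsCadlag (M.trendPath αp βp Z w) :=
  hw.comp (g := fun x => actL (M.proj αp βp) (actL (M.GammaOne .pos) Z + x)) (by fun_prop)

theorem norm_trendPath_sub_le (Z Z' : EuclideanSpace ℝ (Fin (d + 1)))
    (w w' : I → EuclideanSpace ℝ (Fin (d + 1))) (t : I) :
    ‖M.trendPath αp βp Z w t - M.trendPath αp βp Z' w' t‖ ≤
      ‖actL (M.proj αp βp)‖ * (‖actL (M.GammaOne .pos)‖ * ‖Z - Z'‖ + ‖w t - w' t‖) := by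
  rw [trendPath, trendPath, ← map_sub, add_sub_add_comm, ← map_sub]
  exact ContinuousLinearMap.le_opNorm_of_le _
    ((norm_add_le _ _).trans (by gcongr; exact ContinuousLinearMap.le_opNorm _ _))

theorem exists_norm_regulatedTrend_sub_le :
    ∃ K : ℝ≥0, ∀ ⦃Z Z' w w' ε⦄, IsCadlag w → IsCadlag w' → (∀ s, ‖w s - w' s‖ ≤ ε) → ∀ t,
      ‖M.regulatedTrend αp βp Z w t - M.regulatedTrend αp βp Z' w' t‖ ≤ K * (‖Z - Z'‖ + ε) := by
  let ℓ : EuclideanSpace ℝ (Fin (d + 1)) →L[ℝ] ℝ := EuclideanSpace.proj 0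
  let k : EuclideanSpace ℝ (Fin (d + 1)) :=
    (M.kappa αp βp 0)⁻¹ • WithLp.toLp 2 (M.kappa αp βp)
  refine ⟨(1 + ‖ℓ‖₊ * ‖k‖₊) * (‖actL (M.proj αp βp)‖₊ * (‖actL (M.GammaOne .pos)‖₊ + 1)),
    fun Z Z' w w' ε hw hw' h t => ?_⟩
  have hε : 0 ≤ ε := (norm_nonneg _).trans (h t)
  have htrend (s : I) : ‖M.trendPath αp βp Z w s - M.trendPath αp βp Z' w' s‖ ≤
      ‖actL (M.proj αp βp)‖ * (‖actL (M.GammaOne .pos)‖ + 1) * (‖Z - Z'‖ + ε) :=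
    calc ‖M.trendPath αp βp Z w s - M.trendPath αp βp Z' w' s‖
        ≤ ‖actL (M.proj αp βp)‖ * (‖actL (M.GammaOne .pos)‖ * ‖Z - Z'‖ + ε) :=
          (M.norm_trendPath_sub_le αp βp Z Z' w w' s).trans (by gcongr; exact h s)
      _ ≤ ‖actL (M.proj αp βp)‖ * ((‖actL (M.GammaOne .pos)‖ + 1) * (‖Z - Z'‖ + ε)) := by
          gcongr
          nlinarith [norm_nonneg (actL (M.GammaOne .pos)), norm_nonneg (Z - Z')]
      _ = _ := (mul_assoc _ _ _).symm
  refine (norm_regulate_sub_le ℓ k (M.isCadlag_trendPath αp βp Z hw)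
    (M.isCadlag_trendPath αp βp Z' hw') htrend t).trans_eq ?_
  push_cast
  ring

variable (Z₀ : EuclideanSpace ℝ (Fin (d + 1)))

/-- The map of `D[0,1]` which sends the path of the accumulated errors to the path of the limit
process. -/
def limitMap (f : CadlagSpace (EuclideanSpace ℝ (Fin (d + 1)))) :
    CadlagSpace (EuclideanSpace ℝ (Fin (d + 1))) :=
  CadlagSpace.mk (M.regulatedTrend αp βp Z₀ f.path)
    ((M.isCadlag_trendPath αp βp Z₀ f.isCadlag_path).regulate _ _)

theorem limitMap_path (f : CadlagSpace (EuclideanSpace ℝ (Fin (d + 1)))) :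
    (M.limitMap αp βp Z₀ f).path = M.regulatedTrend αp βp Z₀ f.path := rfl

theorem continuous_limitMap : Continuous (M.limitMap αp βp Z₀) := by
  obtain ⟨K, hK⟩ := M.exists_norm_regulatedTrend_sub_le αp βp
  refine (CadlagSpace.lipschitzWith_of_norm_path_sub_le (K := K) fun f g ε h t => ?_).continuous
  simpa only [limitMap_path, sub_self, norm_zero, zero_add] using
    hK (Z := Z₀) (Z' := Z₀) f.isCadlag_path g.isCadlag_path h t

theorem regulatedTrend_step (u : ℕ → EuclideanSpace ℝ (Fin (d + 1)))
    (z₀ : EuclideanSpace ℝ (Fin (d + 1))) {a : ℝ} (ha : 0 ≤ a) (n : ℕ) (t : I) :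
    M.regulatedTrend αp βp (a • z₀) (fun s => a • ∑ i ∈ Finset.Icc 1 ⌊n * (s : ℝ)⌋₊, u i) t =
      a • WithLp.toLp 2 (M.trend αp βp (fun i => (u i).ofLp) z₀.ofLp ⌊n * (t : ℝ)⌋₊ +
        ((M.kappa αp βp 0)⁻¹ * discreteRegulator (fun m =>
          M.trend αp βp (fun i => (u i).ofLp) z₀.ofLp m 0) ⌊n * (t : ℝ)⌋₊) •
          M.kappa αp βp) := by
  let v (m : ℕ) : EuclideanSpace ℝ (Fin (d + 1)) :=
    WithLp.toLp 2 (M.trend αp βp (fun i => (u i).ofLp) z₀.ofLp m)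
  have htrend : M.trendPath αp βp (a • z₀)
      (fun s => a • ∑ i ∈ Finset.Icc 1 ⌊n * (s : ℝ)⌋₊, u i) =
      fun s : I => a • v ⌊n * (s : ℝ)⌋₊ := by
    funext s
    simp only [trendPath, map_smul, ← smul_add]
    simp [v, trend, ← act_eq_actL, act]
  rw [regulatedTrend, htrend, regulate_const_smul _ _ ha, regulate,
    ← regulator_step (fun m => M.trend αp βp _ z₀.ofLp m 0) n t,
    mul_comm (M.kappa αp βp 0)⁻¹, mul_smul]
  rfl

end TrendPath

theorem exists_norm_sub_regulatedTrend_step_le (hαβ : M.PiMat .pos = α * βᵀ) (hβ : β.rank = r)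
    (hαp : IsOrthocomplement α αp) (hβp : IsOrthocomplement β βp) (hκ : M.kappa αp βp 0 < 0)
    (hc : ∃ v, M.PiMat .pos *ᵥ v = M.c) :
    ∃ C : ℝ≥0, ∀ ⦃u : ℕ → EuclideanSpace ℝ (Fin (d + 1))⦄
      ⦃z : ℤ → EuclideanSpace ℝ (Fin (d + 1))⦄ ⦃n B a⦄,
      M.IsPath (fun t => (u t).ofLp) (fun t => (z t).ofLp) →
      ShortMemoryBound l β (fun t => (z t).ofLp) n B → 0 ≤ a → ∀ t : I,
      ‖a • z (⌊n * (t : ℝ)⌋₊ : ℕ) - M.regulatedTrend αp βp (a • z 0)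
        (fun s => a • ∑ i ∈ Finset.Icc 1 ⌊n * (s : ℝ)⌋₊, u i) t‖ ≤ C * (a * B) := by
  obtain ⟨C, hC⟩ := exists_norm_sub_regulated_trend_le hαβ hβ hαp hβp hκ hc
  obtain ⟨K, hK⟩ := exists_norm_toLp_le (Fin (d + 1))
  refine ⟨K * C, fun u z n B a hz hB ha t => ?_⟩
  rw [regulatedTrend_step _ _ _ _ _ ha, ← smul_sub, norm_smul, Real.norm_of_nonneg ha,
    ← WithLp.toLp_ofLp 2 (z (⌊n * (t : ℝ)⌋₊ : ℕ)), ← WithLp.toLp_sub]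
  calc a * _ ≤ a * (K * (C * B)) := by
        gcongr
        exact (hK _).trans (by gcongr; exact hC hz hB _ (floor_mul_le n t))
    _ = (K * C : ℝ≥0) * (a * B) := by push_cast; ring

theorem exists_norm_sub_limitMap_le (hαβ : M.PiMat .pos = α * βᵀ) (hβ : β.rank = r)
    (hαp : IsOrthocomplement α αp) (hβp : IsOrthocomplement β βp) (hκ : M.kappa αp βp 0 < 0)
    (hc : ∃ v, M.PiMat .pos *ᵥ v = M.c) (Z₀ : EuclideanSpace ℝ (Fin (d + 1))) :
    ∃ C : ℝ≥0, ∀ ⦃u : ℕ → EuclideanSpace ℝ (Fin (d + 1))⦄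
      ⦃z : ℤ → EuclideanSpace ℝ (Fin (d + 1))⦄ ⦃n B a⦄,
      M.IsPath (fun t => (u t).ofLp) (fun t => (z t).ofLp) →
      ShortMemoryBound l β (fun t => (z t).ofLp) n B → 0 ≤ a →
      ∀ f : CadlagSpace (EuclideanSpace ℝ (Fin (d + 1))),
      (∀ t, f.path t = a • ∑ i ∈ Finset.Icc 1 ⌊n * (t : ℝ)⌋₊, u i) → ∀ t : I,
      ‖a • z (⌊n * (t : ℝ)⌋₊ : ℕ) - (M.limitMap αp βp Z₀ f).path t‖ ≤
        C * (a * B + ‖a • z 0 - Z₀‖) := by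
  obtain ⟨C, hC⟩ := exists_norm_sub_regulatedTrend_step_le hαβ hβ hαp hβp hκ hc
  obtain ⟨K, hK⟩ := M.exists_norm_regulatedTrend_sub_le αp βp
  refine ⟨C + K, fun u z n B a hz hB ha f hf t => ?_⟩
  have happrox := hC hz hB ha t
  rw [← funext hf] at happrox
  have hstart := hK (Z := a • z 0) (Z' := Z₀) f.isCadlag_path f.isCadlag_path
    (fun s => (norm_sub_eq_zero_iff.2 rfl).le) t
  have haB : 0 ≤ a * B := mul_nonneg ha hB.nonneg
  calc _ ≤ C * (a * B) + K * (‖a • z 0 - Z₀‖ + 0) :=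
        (norm_sub_le_norm_sub_add_norm_sub _ _ _).trans (add_le_add happrox hstart)
    _ ≤ (C + K) * (a * B + ‖a • z 0 - Z₀‖) := by
        nlinarith [mul_nonneg K.coe_nonneg haB,
          mul_nonneg C.coe_nonneg (norm_nonneg (a • z 0 - Z₀))]

end CKSVAR

/-! ### Convergence in probability and in distribution -/

section Convergence

variable {Ω ι : Type*} [MeasurableSpace Ω] {P : Measure Ω} {l : Filter ι}

theorem tendstoInMeasure_const {E : Type*} [PseudoEMetricSpace E] {x : ι → E} {a : E}
    (h : Tendsto x l (𝓝 a)) : TendstoInMeasure P (fun i _ => x i) l (fun _ => a) := by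
  intro ε hε
  refine tendsto_const_nhds.congr' ?_
  filter_upwards [h.eventually (Metric.eball_mem_nhds a hε)] with i hi
  simp [not_le.2 (show edist (x i) a < ε from hi)]

theorem tendstoInMeasure_add {E : Type*} [SeminormedAddCommGroup E] {f g : ι → Ω → E}
    {f' g' : Ω → E} (hf : TendstoInMeasure P f l f') (hg : TendstoInMeasure P g l g') :
    TendstoInMeasure P (fun i ω => f i ω + g i ω) l (fun ω => f' ω + g' ω) := by
  intro ε hε
  have h := (hf (ε / 2) (ENNReal.half_pos hε.ne')).add (hg (ε / 2) (ENNReal.half_pos hε.ne'))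
  rw [add_zero] at h
  refine tendsto_of_tendsto_of_tendsto_of_le_of_le tendsto_const_nhds h (fun _ => zero_le)
    fun i => (measure_mono fun ω hω => ?_).trans (measure_union_le _ _)
  by_contra! hlt
  simp only [Set.mem_union, Set.mem_ofPred_eq, not_or, not_le] at hlt
  refine (lt_of_le_of_lt (edist_add_add_le _ _ _ _) (ENNReal.add_lt_add hlt.1 hlt.2)).not_ge ?_
  rwa [ENNReal.add_halves]

theorem tendstoInMeasure_zero_of_norm_le_mul {E F : Type*} [SeminormedAddCommGroup E]
    [SeminormedAddCommGroup F] {f : ι → Ω → E} {g : ι → Ω → F} (C : ℝ≥0)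
    (hg : TendstoInMeasure P g l (fun _ => 0)) (h : ∀ i ω, ‖f i ω‖ ≤ C * ‖g i ω‖) :
    TendstoInMeasure P f l (fun _ => 0) := by
  simp only [tendstoInMeasure_iff_norm, sub_zero] at hg ⊢
  intro ε hε
  refine tendsto_of_tendsto_of_tendsto_of_le_of_le tendsto_const_nhds
    (hg (ε / (C + 1)) (by positivity)) (fun _ => zero_le) fun i => measure_mono fun ω hω => ?_
  simp only [Set.mem_ofPred_eq] at hω ⊢
  rw [div_le_iff₀ (by positivity)]
  linarith [h i ω, norm_nonneg (g i ω)]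

theorem norm_integral_sub_integral_le [IsProbabilityMeasure P] {E : Type*} [NormedAddCommGroup E]
    [NormedSpace ℝ E] {f g : Ω → E} (hf : Integrable f P) (hg : Integrable g P) {A : Set Ω}
    {η C : ℝ} (hη₀ : 0 ≤ η) (hη : ∀ ω ∉ A, ‖f ω - g ω‖ ≤ η)
    (hC : ∀ ω, ‖f ω - g ω‖ ≤ C) :
    ‖∫ ω, f ω ∂P - ∫ ω, g ω ∂P‖ ≤ η + C * P.real A := by
  set A' := toMeasurable P A with hA'
  have hA'm : MeasurableSet A' := measurableSet_toMeasurable P A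
  have hbound : ∀ ω, ‖f ω - g ω‖ ≤ η + A'.indicator (fun _ => C) ω := by
    intro ω
    by_cases hω : ω ∈ A'
    · rw [Set.indicator_of_mem hω]
      linarith [hC ω]
    · rw [Set.indicator_of_notMem hω, add_zero]
      exact hη ω fun h => hω (subset_toMeasurable P A h)
  have hint : Integrable (A'.indicator fun _ => C) P := (integrable_const C).indicator hA'm
  rw [← integral_sub hf hg]
  calc ‖∫ ω, (f ω - g ω) ∂P‖ ≤ ∫ ω, (η + A'.indicator (fun _ => C) ω) ∂P :=
        norm_integral_le_of_norm_le ((integrable_const η).add hint) (ae_of_all _ hbound)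
    _ = η + C * P.real A := by
      rw [integral_add (integrable_const η) hint, integral_indicator_const C hA'm, hA',
        measureReal_def, measure_toMeasurable, ← measureReal_def]
      simp [mul_comm]

/-- Mathlib's version of this fact is about normed groups with measurable addition, hence does not
apply to `CadlagSpace`. -/
theorem tendstoInDistribution_of_tendsto_measure_edist {Ω' : Type*} [MeasurableSpace Ω']
    {P' : Measure Ω'} [IsProbabilityMeasure P] [IsProbabilityMeasure P'] [l.IsCountablyGenerated]
    {E : Type*} [PseudoEMetricSpace E] [MeasurableSpace E] [BorelSpace E] {X Y : ι → Ω → E}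
    {Z : Ω' → E} (hX : TendstoInDistribution X l Z (fun _ => P) P')
    (hY : ∀ i, AEMeasurable (Y i) P)
    (h : ∀ ε, 0 < ε → Tendsto (fun i => P {ω | ε ≤ edist (Y i ω) (X i ω)}) l (𝓝 0)) :
    TendstoInDistribution Y l Z (fun _ => P) P' := by
  have hXm := hX.forall_aemeasurable
  refine ⟨hY, hX.aemeasurable_limit, tendsto_iff_forall_lipschitz_integral_tendsto.2 ?_⟩
  rintro F ⟨C, hC⟩ ⟨K, hK⟩
  have hFX := tendsto_iff_forall_lipschitz_integral_tendsto.1 hX.tendsto F ⟨C, hC⟩ ⟨K, hK⟩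
  simp only [ProbabilityMeasure.coe_mk] at hFX ⊢
  let F' := BoundedContinuousFunction.mkOfBound ⟨F, hK.continuous⟩ C hC
  have hmap : ∀ {W : Ω → E}, AEMeasurable W P → ∫ x, F x ∂(P.map W) = ∫ ω, F (W ω) ∂P :=
    fun hW => integral_map hW hK.continuous.measurable.aestronglyMeasurable
  have hint : ∀ {W : Ω → E}, AEMeasurable W P → Integrable (fun ω => F (W ω)) P :=
    fun hW => (F'.integrable (P.map _)).comp_aemeasurable hW
  simp only [hmap (hY _), hmap (hXm _)] at hFX ⊢
  refine hFX.congr_dist ?_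
  rw [Metric.tendsto_nhds]
  intro ε hε
  set η : ℝ := ε / (2 * (K + 1)) with hη
  have hη₀ : 0 < η := by positivity
  have hKη : K * η < ε / 2 := by
    rw [hη, ← mul_div_assoc, div_lt_div_iff₀ (by positivity) two_pos]
    nlinarith [K.coe_nonneg]
  set A : ι → Set Ω := fun i => {ω | ENNReal.ofReal η ≤ edist (Y i ω) (X i ω)}
  have hA : Tendsto (fun i => C * P.real (A i)) l (𝓝 0) := by
    have := (ENNReal.tendsto_toReal ENNReal.zero_ne_top).comp (h _ (ENNReal.ofReal_pos.2 hη₀))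
    simpa [A, measureReal_def] using this.const_mul C
  filter_upwards [hA.eventually_lt_const (half_pos hε)] with i hi
  rw [dist_zero_right, Real.norm_of_nonneg dist_nonneg, dist_comm, dist_eq_norm]
  have hclose : ∀ ω ∉ A i, ‖F (Y i ω) - F (X i ω)‖ ≤ K * η := by
    intro ω hω
    have hedist : edist (F (Y i ω)) (F (X i ω)) ≤ ENNReal.ofReal (K * η) := by
      rw [ENNReal.ofReal_mul K.coe_nonneg, ENNReal.ofReal_coe_nnreal]
      exact hK.edist_le_mul_of_le (not_le.1 hω).le
    rwa [edist_dist, ENNReal.ofReal_le_ofReal_iff (by positivity), dist_eq_norm] at hedist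
  have := norm_integral_sub_integral_le (hint (hY i)) (hint (hXm i)) (by positivity) hclose
    fun ω => hC _ _
  linarith

theorem tendsto_measure_edist_of_ae_edist_le {E : Type*} [PseudoEMetricSpace E]
    {X Y : ι → Ω → E} {g : ι → Ω → ℝ} (hg : TendstoInMeasure P g l (fun _ => 0))
    (h : ∀ i, ∀ᵐ ω ∂P, edist (Y i ω) (X i ω) ≤ ENNReal.ofReal (g i ω)) {ε : ℝ≥0∞} (hε : 0 < ε) :
    Tendsto (fun i => P {ω | ε ≤ edist (Y i ω) (X i ω)}) l (𝓝 0) := by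
  refine tendsto_of_tendsto_of_tendsto_of_le_of_le tendsto_const_nhds (hg ε hε)
    (fun _ => zero_le) fun i => measure_mono_ae ?_
  filter_upwards [h i] with ω hω hle
  have hnorm : ENNReal.ofReal (g i ω) ≤ edist (g i ω) 0 := by
    rw [edist_zero_right, ← ofReal_norm]
    exact ENNReal.ofReal_le_ofReal (Real.le_norm_self _)
  exact (hle.trans hω).trans hnorm

end Convergence

/-! ### Maxima of random vectors -/

/-- The maximum `max_{i ∈ T} ‖x i‖`, which is `0` if `T` is empty; it is the size of a finite family
of vectors, in the form in which it occurs in `IsStarStationary`. -/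
def maxNorm {ι E : Type*} [NormedAddCommGroup E] (T : Finset ι) (x : ι → E) : ℝ :=
  ((T.sup fun i => ‖x i‖₊ : ℝ≥0) : ℝ)

section MaxNorm

variable {ι E : Type*} [NormedAddCommGroup E] {T : Finset ι} {x : ι → E}

theorem maxNorm_nonneg (T : Finset ι) (x : ι → E) : 0 ≤ maxNorm T x :=
  NNReal.coe_nonneg _

theorem norm_le_maxNorm {i : ι} (hi : i ∈ T) : ‖x i‖ ≤ maxNorm T x := by
  exact_mod_cast Finset.le_sup (f := fun i => ‖x i‖₊) hi

theorem maxNorm_le {a : ℝ≥0} (h : ∀ i ∈ T, ‖x i‖ ≤ a) : maxNorm T x ≤ a := by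
  exact_mod_cast (Finset.sup_le fun i hi => by exact_mod_cast h i hi :
    T.sup (fun i => ‖x i‖₊) ≤ a)

theorem exists_le_norm_of_le_maxNorm {a : ℝ≥0} (ha : 0 < a) (h : a ≤ maxNorm T x) :
    ∃ i ∈ T, a ≤ ‖x i‖₊ :=
  (Finset.le_sup_iff ha).1 (by exact_mod_cast h)

end MaxNorm

section Moments

theorem mul_inv_sqrt_rpow {x : ℝ≥0} (hx : x ≠ 0) (m : ℝ) :
    x * (NNReal.sqrt x)⁻¹ ^ m = x ^ (-(m / 2 - 1)) := by
  rw [NNReal.sqrt_eq_rpow, NNReal.inv_rpow, ← NNReal.rpow_mul, ← NNReal.rpow_neg]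
  nth_rewrite 1 [← NNReal.rpow_one x]
  rw [← NNReal.rpow_add hx]
  ring_nf

variable {Ω ι κ E : Type*} [MeasurableSpace Ω] {P : Measure Ω} [NormedAddCommGroup E]
  {f : ι → Ω → E} {s : Set ι} {m : ℝ}

theorem BoundedMoments.exists_measure_le_maxNorm_le (hm : 0 < m) (h : BoundedMoments f s m P) :
    ∃ C : ℝ≥0, ∀ (T : Finset κ) (g : κ → ι), (∀ i ∈ T, g i ∈ s) → ∀ a : ℝ≥0, 0 < a →
      P {ω | a ≤ maxNorm T fun i => f (g i) ω} ≤ (T.card * (a⁻¹ * C) ^ m : ℝ≥0) := by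
  obtain ⟨hmeas, C, hC⟩ := h
  refine ⟨C, fun T g hg a ha => ?_⟩
  have hsub : {ω | a ≤ maxNorm T fun i => f (g i) ω} ⊆
      ⋃ i ∈ T, {ω | (a : ℝ≥0∞) ≤ ‖f (g i) ω‖ₑ} := by
    intro ω hω
    obtain ⟨i, hi, hle⟩ := exists_le_norm_of_le_maxNorm ha hω
    exact Set.mem_biUnion hi (ENNReal.coe_le_coe.2 hle)
  have hmarkov : ∀ i ∈ T, P {ω | (a : ℝ≥0∞) ≤ ‖f (g i) ω‖ₑ} ≤ ((a⁻¹ * C) ^ m : ℝ≥0) := by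
    intro i hi
    have := meas_ge_le_mul_pow_eLpNorm_enorm P (p := ENNReal.ofReal m) (by simpa using hm)
      ENNReal.ofReal_ne_top (hmeas _ (hg i hi)) (ENNReal.coe_ne_zero.2 ha.ne') (by simp)
    refine this.trans ?_
    rw [ENNReal.toReal_ofReal hm.le, ← ENNReal.mul_rpow_of_nonneg _ _ hm.le,
      ENNReal.coe_rpow_of_nonneg _ hm.le, ENNReal.coe_mul, ENNReal.coe_inv ha.ne']
    gcongr
    exact hC _ (hg i hi)
  calc P {ω | a ≤ maxNorm T fun i => f (g i) ω}
      ≤ ∑ i ∈ T, P {ω | (a : ℝ≥0∞) ≤ ‖f (g i) ω‖ₑ} :=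
        (measure_mono hsub).trans (measure_biUnion_finset_le _ _)
    _ ≤ ∑ _i ∈ T, (((a⁻¹ * C) ^ m : ℝ≥0) : ℝ≥0∞) := Finset.sum_le_sum hmarkov
    _ = (T.card * (a⁻¹ * C) ^ m : ℝ≥0) := by simp

theorem BoundedMoments.tendstoInMeasure_maxNorm (hm : 2 < m) (h : BoundedMoments f s m P)
    {T : ℕ → Finset κ} {g : ℕ → κ → ι} (hg : ∀ n, ∀ i ∈ T n, g n i ∈ s) {K : ℕ}
    (hT : ∀ n ≠ 0, (T n).card ≤ K * n) :
    TendstoInMeasure P (fun (n : ℕ) ω => (√(n : ℝ))⁻¹ * maxNorm (T n) fun i => f (g n i) ω) atTop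
      (fun _ => 0) := by
  obtain ⟨C, hC⟩ := h.exists_measure_le_maxNorm_le (κ := κ) (two_pos.trans hm)
  simp only [tendstoInMeasure_iff_norm, sub_zero]
  intro ε hε
  lift ε to ℝ≥0 using hε.le
  rw [NNReal.coe_pos] at hε
  have hlim : Tendsto (fun n : ℕ =>
      ((K * (ε⁻¹ * C) ^ m * (n : ℝ≥0) ^ (-(m / 2 - 1)) : ℝ≥0) : ℝ≥0∞)) atTop (𝓝 0) := by
    have hpow : Tendsto (fun n : ℕ => (n : ℝ≥0) ^ (-(m / 2 - 1))) atTop (𝓝 0) := by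
      rw [← NNReal.tendsto_coe]
      simpa [Function.comp_def] using
        (tendsto_rpow_neg_atTop (y := m / 2 - 1) (by linarith)).comp tendsto_natCast_atTop_atTop
    simpa using ENNReal.tendsto_coe.2 (hpow.const_mul (K * (ε⁻¹ * C) ^ m))
  refine tendsto_of_tendsto_of_tendsto_of_le_of_le' tendsto_const_nhds hlim
    (Eventually.of_forall fun _ => zero_le) ?_
  filter_upwards [eventually_ne_atTop 0] with n hn
  have hn₀ : (0 : ℝ≥0) < n := by exact_mod_cast Nat.pos_of_ne_zero hn
  have hset : {ω | ε ≤ ‖(√(n : ℝ))⁻¹ * maxNorm (T n) fun i => f (g n i) ω‖} =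
      {ω | (ε * NNReal.sqrt n : ℝ≥0) ≤ maxNorm (T n) fun i => f (g n i) ω} := by
    ext ω
    have hsqrt : 0 < √(n : ℝ) := Real.sqrt_pos.2 hn₀
    simp only [Set.mem_ofPred_eq]
    rw [Real.norm_of_nonneg (mul_nonneg (by positivity) (maxNorm_nonneg _ _)),
      le_inv_mul_iff₀' hsqrt]
    simp
  rw [hset]
  refine (hC (T n) (g n) (hg n) _ (mul_pos hε (NNReal.sqrt_pos.2 hn₀))).trans ?_
  rw [ENNReal.coe_le_coe]
  calc ((T n).card : ℝ≥0) * ((ε * NNReal.sqrt n)⁻¹ * C) ^ m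
      ≤ (K * n : ℕ) * ((ε * NNReal.sqrt n)⁻¹ * C) ^ m := by gcongr; exact hT n hn
    _ = K * (ε⁻¹ * C) ^ m * (n * (NNReal.sqrt n)⁻¹ ^ m) := by
      rw [mul_inv, mul_right_comm, NNReal.mul_rpow, Nat.cast_mul]
      ring
    _ = K * (ε⁻¹ * C) ^ m * (n : ℝ≥0) ^ (-(m / 2 - 1)) := by
      rw [mul_inv_sqrt_rpow hn₀.ne']

end Moments

/-! ### The limit process -/

section BrownianMotion

variable {ι : Type*} [Fintype ι] [DecidableEq ι] {S : Matrix ι ι ℝ}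

theorem map_innerSL_multivariateGaussian (hS : S.PosSemidef) (a : EuclideanSpace ℝ ι) :
    (multivariateGaussian 0 S).map (innerSL ℝ a) =
      gaussianReal 0 (a.ofLp ⬝ᵥ S *ᵥ a.ofLp).toNNReal := by
  rw [IsGaussian.map_eq_gaussianReal, ContinuousLinearMap.integral_comp_id_comm
    IsGaussian.integrable_id, integral_id_multivariateGaussian, map_zero,
    ← covarianceBilin_multivariateGaussian (μ := 0) hS, covarianceBilin_self]
  · rfl
  · exact IsGaussian.memLp_two_id

theorem IsBrownianMotion.isScalarBrownianMotion_add_innerSL {Ω : Type*} [MeasurableSpace Ω]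
    {P : Measure Ω} {W : I → Ω → EuclideanSpace ℝ ι} (hW : IsBrownianMotion W S P)
    (hS : S.PosSemidef) (w₀ : ℝ) (a : EuclideanSpace ℝ ι) :
    IsScalarBrownianMotion (fun t ω => w₀ + innerSL ℝ a (W t ω)) w₀
      (a.ofLp ⬝ᵥ S *ᵥ a.ofLp).toNNReal P where
  start := by
    filter_upwards [hW.start] with ω hω
    rw [hω, map_zero, add_zero]
  indep n t ht := by
    simpa only [add_sub_add_left_eq_sub] using hW.indep.map (innerSL ℝ a) n t ht
  law s t hst := by
    have hst' : 0 ≤ (t : ℝ) - s := sub_nonneg.2 hst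
    have hmap := map_innerSL_multivariateGaussian (hS.smul hst') a
    rw [Matrix.smul_mulVec, dotProduct_smul, smul_eq_mul, Real.toNNReal_mul hst'] at hmap
    simp only [add_sub_add_left_eq_sub, ← map_sub]
    exact (HasLaw.mk (innerSL ℝ a).measurable.aemeasurable hmap).comp (hW.law s t hst)
  cont := by
    filter_upwards [hW.cont] with ω hω
    fun_prop

end BrownianMotion

namespace CKSVAR

variable {d l r q : ℕ} {M : CKSVAR d l} {α β : Matrix (Fin (d + 1)) (Fin r) ℝ}
  {αp βp : Matrix (Fin (d + 1)) (Fin q) ℝ} {Z₀ : EuclideanSpace ℝ (Fin (d + 1))}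

theorem commonTrends_zero_nonneg (hrank : M.PiX.rank < (M.PiMat .neg).rank)
    (h : Z₀ ∈ M.commonTrends) : 0 ≤ Z₀ 0 := by
  by_contra! hneg
  have hker : max (Z₀ 0) 0 • M.pi .pos + min (Z₀ 0) 0 • M.pi .neg +
      M.PiX *ᵥ (fun j => Z₀ j.succ) = 0 := h
  rw [max_eq_right hneg.le, min_eq_left hneg.le, zero_smul, zero_add] at hker
  let w : Fin d → ℝ := (-(Z₀ 0)⁻¹) • fun j => Z₀ j.succ
  have hpi : M.pi .neg = M.PiX *ᵥ w := by
    rw [Matrix.mulVec_smul, eq_neg_of_add_eq_zero_right hker, neg_smul, smul_neg, neg_neg,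
      smul_smul, inv_mul_cancel₀ hneg.ne, one_smul]
  have hfactor : M.PiMat .neg = M.PiX * colCons w 1 := by
    ext a b
    rw [PiMat, hpi, Matrix.mul_apply]
    refine Fin.cases ?_ (fun b => ?_) b
    · simp [colCons, Matrix.mulVec, dotProduct]
    · simp [colCons, Matrix.one_apply]
  rw [hfactor] at hrank
  exact (Matrix.rank_mul_le_left _ _).not_gt hrank

theorem transpose_mulVec_eq_zero_of_mem_commonTrends (hαβ : M.PiMat .pos = α * βᵀ)
    (hα : α.rank = r) (h₀ : 0 ≤ Z₀ 0) (h : Z₀ ∈ M.commonTrends) : βᵀ *ᵥ Z₀.ofLp = 0 := by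
  have hker : max (Z₀ 0) 0 • M.pi .pos + min (Z₀ 0) 0 • M.pi .neg +
      M.PiX *ᵥ (fun j => Z₀ j.succ) = 0 := h
  rw [max_eq_left h₀, min_eq_right h₀, zero_smul, add_zero] at hker
  have hPi : M.PiMat .pos *ᵥ Z₀.ofLp = 0 := by rw [PiMat, colCons_mulVec, hker]
  rw [hαβ, ← Matrix.mulVec_mulVec] at hPi
  apply mulVec_injective_of_rank_eq_card (hα.trans (Fintype.card_fin r).symm)
  rw [hPi, Matrix.mulVec_zero]

theorem limitPath_zero {Ω' : Type*} {U : I → Ω' → EuclideanSpace ℝ (Fin (d + 1))}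
    (hκ : M.kappa αp βp 0 ≠ 0) (t : I) (ω : Ω') :
    M.limitPath αp βp Z₀ U t ω 0 = M.projU αp βp Z₀ U t ω 0 +
      regulator (fun s => M.projU αp βp Z₀ U s ω 0) t := by
  simp only [limitPath, PiLp.add_apply, PiLp.smul_apply, smul_eq_mul]
  congr 1
  field_simp

variable {Ω' : Type*} [MeasurableSpace Ω'] {P' : Measure Ω'}
  {U : I → Ω' → EuclideanSpace ℝ (Fin (d + 1))} {S : Matrix (Fin (d + 1)) (Fin (d + 1)) ℝ}

theorem isScalarBrownianMotion_projU_zero (hU : IsBrownianMotion U S P') (hS : S.PosSemidef)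
    (hfix : M.proj αp βp *ᵥ M.GammaOne .pos *ᵥ Z₀.ofLp = Z₀.ofLp) :
    IsScalarBrownianMotion (fun t ω => M.projU αp βp Z₀ U t ω 0) (Z₀ 0)
      (M.proj αp βp 0 ⬝ᵥ S *ᵥ M.proj αp βp 0).toNNReal P' := by
  let a : EuclideanSpace ℝ (Fin (d + 1)) := WithLp.toLp 2 (M.proj αp βp 0)
  have hproj : (fun t ω => M.projU αp βp Z₀ U t ω 0) =
      fun t ω => Z₀ 0 + innerSL ℝ a (U t ω) := by
    funext t ω
    calc M.projU αp βp Z₀ U t ω 0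
        = (M.proj αp βp *ᵥ (M.GammaOne .pos *ᵥ Z₀.ofLp + (U t ω).ofLp)) 0 := rfl
      _ = Z₀ 0 + (M.proj αp βp *ᵥ (U t ω).ofLp) 0 := by
        rw [Matrix.mulVec_add, hfix, Pi.add_apply]
      _ = Z₀ 0 + innerSL ℝ a (U t ω) := by
        simp [a, PiLp.inner_apply, Matrix.mulVec, dotProduct, mul_comm]
  rw [hproj]
  exact hU.isScalarBrownianMotion_add_innerSL hS (Z₀ 0) a

theorem isRegulatedBrownianMotion_limitPath_zero (hU : IsBrownianMotion U S P') (hS : S.PosDef)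
    (hκ : M.kappa αp βp 0 ≠ 0) (h₀ : 0 ≤ Z₀ 0)
    (hfix : M.proj αp βp *ᵥ M.GammaOne .pos *ᵥ Z₀.ofLp = Z₀.ofLp) :
    IsRegulatedBrownianMotion (fun t ω => M.limitPath αp βp Z₀ U t ω 0) (Z₀ 0) P' := by
  refine ⟨h₀, _, _, ?_, isScalarBrownianMotion_projU_zero hU hS.posSemidef hfix,
    ae_of_all _ fun ω t => limitPath_zero hκ t ω⟩
  have hrow : M.proj αp βp 0 ≠ 0 := by
    intro h
    rw [kappa, Matrix.mulVec, h, zero_dotProduct] at hκ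
    exact hκ rfl
  simpa using hS.dotProduct_mulVec_pos hrow

end CKSVAR

/-! ### Asymptotics of the CKSVAR -/

theorem norm_ofLp_le {ι : Type*} [Fintype ι] (v : EuclideanSpace ℝ ι) : ‖v.ofLp‖ ≤ ‖v‖ :=
  (pi_norm_le_iff_of_nonneg (norm_nonneg _)).2 fun i => PiLp.norm_apply_le v i

theorem isStarStationary_of_norm_le {Ω E : Type*} [MeasurableSpace Ω] {P : Measure Ω}
    [NormedAddCommGroup E] {w : ℕ → ℕ → Ω → E} {B : ℕ → Ω → ℝ} (C : ℝ≥0)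
    (hB : TendstoInMeasure P (fun (n : ℕ) ω => (√(n : ℝ))⁻¹ * B n ω) atTop (fun _ => 0))
    (h : ∀ n ω t, 1 ≤ t → t ≤ n → ‖w n t ω‖ ≤ C * B n ω) : IsStarStationary w P := by
  refine tendstoInMeasure_zero_of_norm_le_mul C hB fun n ω => ?_
  have hmax : maxNorm (Finset.Icc 1 n) (fun t => w n t ω) ≤ (C * ‖B n ω‖₊ : ℝ≥0) :=
    maxNorm_le fun t ht => (h n ω t (Finset.mem_Icc.1 ht).1 (Finset.mem_Icc.1 ht).2).trans
      (mul_le_mul_of_nonneg_left (Real.le_norm_self _) C.coe_nonneg)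
  calc ‖(√(n : ℝ))⁻¹ * maxNorm (Finset.Icc 1 n) fun t => w n t ω‖
      = (√(n : ℝ))⁻¹ * maxNorm (Finset.Icc 1 n) fun t => w n t ω :=
        Real.norm_of_nonneg (mul_nonneg (by positivity) (maxNorm_nonneg _ _))
    _ ≤ (√(n : ℝ))⁻¹ * (C * ‖B n ω‖₊ : ℝ≥0) := by gcongr
    _ = C * ‖(√(n : ℝ))⁻¹ * B n ω‖ := by
      rw [norm_mul, Real.norm_of_nonneg (by positivity : 0 ≤ (√(n : ℝ))⁻¹), NNReal.coe_mul,
        coe_nnnorm]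
      ring

namespace CKSVAR

variable {d l r q : ℕ} {M : CKSVAR d l} {α β : Matrix (Fin (d + 1)) (Fin r) ℝ}
  {αp βp : Matrix (Fin (d + 1)) (Fin q) ℝ} {Z₀ : EuclideanSpace ℝ (Fin (d + 1))} {δ : ℝ}
  {Ω : Type*} {u : ℕ → Ω → EuclideanSpace ℝ (Fin (d + 1))}

theorem IsGenerated.isPath {z : ℤ → Ω → EuclideanSpace ℝ (Fin (d + 1))} (h : M.IsGenerated u z)
    (ω : Ω) : M.IsPath (fun t => (u t ω).ofLp) (fun t => (z t ω).ofLp) :=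
  fun t ht => congrArg WithLp.ofLp (h t ht ω)

variable {z : ℕ → ℤ → Ω → EuclideanSpace ℝ (Fin (d + 1))}

/-- The size of the inputs of the sample of size `n`: a bound in the sense of `InputBound` for the
shocks and for the short-memory components of the initial values, which is a sum of maxima. -/
def inputSize (l : ℕ) (β : Matrix (Fin (d + 1)) (Fin r) ℝ)
    (u : ℕ → Ω → EuclideanSpace ℝ (Fin (d + 1)))
    (z : ℕ → ℤ → Ω → EuclideanSpace ℝ (Fin (d + 1))) (n : ℕ) (ω : Ω) : ℝ :=
  1 + maxNorm (Finset.Icc 1 n) (fun t => u t ω) +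
    maxNorm (Finset.Icc (-(l + 1 : ℤ)) 0) (fun t => act βᵀ (z n t ω)) +
    maxNorm (Finset.Icc (-(l : ℤ)) 0) (fun t => z n t ω - z n (t - 1) ω) +
    maxNorm (Finset.Icc (-(l + 1 : ℤ)) 0) (fun t => min (z n t ω 0) 0)

theorem inputBound_inputSize (n : ℕ) (ω : Ω) :
    InputBound l β (fun t => (u t ω).ofLp) (fun t => (z n t ω).ofLp) n
      (inputSize l β u z n ω) := by
  have hu := maxNorm_nonneg (Finset.Icc 1 n) (fun t => u t ω)
  have he := maxNorm_nonneg (Finset.Icc (-(l + 1 : ℤ)) 0) (fun t => act βᵀ (z n t ω))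
  have hd := maxNorm_nonneg (Finset.Icc (-(l : ℤ)) 0) (fun t => z n t ω - z n (t - 1) ω)
  have hy := maxNorm_nonneg (Finset.Icc (-(l + 1 : ℤ)) 0) (fun t => min (z n t ω 0) 0)
  unfold inputSize
  refine ⟨⟨fun t ht => ?_, fun t hlt ht => ?_, fun t hlt ht => ?_⟩, by linarith,
    fun t hlt ht => ?_⟩
  · have := (norm_ofLp_le _).trans (norm_le_maxNorm (x := fun t => act βᵀ (z n t ω))
      (Finset.mem_Icc.2 (by omega : -(l + 1 : ℤ) ≤ t ∧ (t : ℤ) ≤ 0)))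
    exact this.trans (by linarith)
  · have := (norm_ofLp_le _).trans (norm_le_maxNorm (T := Finset.Icc (-(l : ℤ)) 0)
      (x := fun t => z n t ω - z n (t - 1) ω) (Finset.mem_Icc.2 ⟨hlt, ht⟩))
    exact this.trans (by linarith)
  · have := norm_le_maxNorm (T := Finset.Icc (-(l + 1 : ℤ)) 0)
      (x := fun t => min (z n t ω 0) 0) (Finset.mem_Icc.2 ⟨hlt, ht⟩)
    exact this.trans (by linarith)
  · have := (norm_ofLp_le _).trans (norm_le_maxNorm (x := fun t => u t ω)
      (Finset.mem_Icc.2 ⟨hlt, ht⟩))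
    exact this.trans (by linarith)

theorem continuous_lag (M : CKSVAR d l) (i : ℕ) :
    Continuous fun x : EuclideanSpace ℝ (Fin (d + 1)) =>
      max (x 0) 0 • M.phi .pos i + min (x 0) 0 • M.phi .neg i +
        M.PhiX i *ᵥ (fun j => x j.succ) :=
  Continuous.add (by fun_prop) (continuous_const.matrix_mulVec (by fun_prop))

variable [MeasurableSpace Ω] {P : Measure Ω}

theorem IsGenerated.aemeasurable {z : ℤ → Ω → EuclideanSpace ℝ (Fin (d + 1))}
    (h : M.IsGenerated u z) (hu : ∀ t, 1 ≤ t → AEMeasurable (u t) P)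
    (hz : ∀ t : ℤ, -(l + 1 : ℤ) ≤ t → t ≤ 0 → AEMeasurable (z t) P) (n : ℕ) :
    ∀ t : ℤ, -(l + 1 : ℤ) ≤ t → t ≤ n → AEMeasurable (z t) P := by
  induction n with
  | zero => exact_mod_cast hz
  | succ n ih =>
    intro t hlt ht
    rcases (Int.le_iff_lt_or_eq.1 ht) with hlt' | rfl
    · exact ih t hlt (by push_cast at hlt'; omega)
    · rw [funext (h (n + 1) (by omega))]
      refine AEMeasurable.add ?_ (hu (n + 1) (by omega))
      refine (PiLp.continuous_toLp 2 _).measurable.comp_aemeasurable (.const_add ?_ _)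
      refine Finset.aemeasurable_fun_sum _ fun i hi => ?_
      have hi' := Finset.mem_Icc.1 hi
      exact (M.continuous_lag i).measurable.comp_aemeasurable
        (ih ((n + 1 : ℕ) - i) (by omega) (by push_cast; omega))

theorem tendstoInMeasure_inputSize (hδ : 0 < δ) (hu : BoundedMoments u {t | 1 ≤ t} (2 + δ) P)
    (hinit : InitialCondition M P β δ z Z₀) :
    TendstoInMeasure P (fun (n : ℕ) ω => (√(n : ℝ))⁻¹ * inputSize l β u z n ω) atTop
      (fun _ => 0) := by
  have hm : 2 < 2 + δ := by linarith
  have hcard (a : ℤ) (n : ℕ) (hn : n ≠ 0) :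
      (Finset.Icc a 0).card ≤ (Finset.Icc a 0).card * n :=
    Nat.le_mul_of_pos_right _ (Nat.pos_of_ne_zero hn)
  have hone : TendstoInMeasure P (fun (n : ℕ) (_ : Ω) => (√(n : ℝ))⁻¹) atTop (fun _ => 0) :=
    tendstoInMeasure_const (tendsto_inv_atTop_zero.comp
      (Real.tendsto_sqrt_atTop.comp tendsto_natCast_atTop_atTop))
  have hshock := hu.tendstoInMeasure_maxNorm hm (T := fun n => Finset.Icc 1 n) (g := fun _ t => t)
    (fun n t ht => (Finset.mem_Icc.1 ht).1) (K := 1) (by simp)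
  have heqErr := hinit.moments_eqErr.tendstoInMeasure_maxNorm hm
    (T := fun _ => Finset.Icc (-(l + 1 : ℤ)) 0) (g := fun n t => (n, t))
    (fun n t ht => Finset.mem_Icc.1 ht) (hcard _)
  have hdiff := hinit.moments_diff.tendstoInMeasure_maxNorm hm
    (T := fun _ => Finset.Icc (-(l : ℤ)) 0) (g := fun n t => (n, t))
    (fun n t ht => Finset.mem_Icc.1 ht) (hcard _)
  have hneg := hinit.moments_neg.tendstoInMeasure_maxNorm hm
    (T := fun _ => Finset.Icc (-(l + 1 : ℤ)) 0) (g := fun n t => (n, t))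
    (fun n t ht => Finset.mem_Icc.1 ht) (hcard _)
  have hsum := tendstoInMeasure_add (tendstoInMeasure_add (tendstoInMeasure_add
    (tendstoInMeasure_add hone hshock) heqErr) hdiff) hneg
  simpa only [inputSize, mul_add, mul_one, add_zero] using hsum

theorem exists_shortMemoryBound_tendstoInMeasure (hαβ : M.PiMat .pos = α * βᵀ)
    (hjsr : jointSpectralRadius {M.F α β 0, M.F α β 1} < 1) (hz : ∀ n, M.IsGenerated u (z n))
    (hδ : 0 < δ) (hu : BoundedMoments u {t | 1 ≤ t} (2 + δ) P)
    (hinit : InitialCondition M P β δ z Z₀) :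
    ∃ B : ℕ → Ω → ℝ, (∀ n ω, ShortMemoryBound l β (fun t => (z n t ω).ofLp) n (B n ω)) ∧
      TendstoInMeasure P (fun (n : ℕ) ω => (√(n : ℝ))⁻¹ * B n ω) atTop (fun _ => 0) := by
  obtain ⟨C, hC⟩ := exists_shortMemoryBound hαβ hjsr
  refine ⟨fun n ω => C * inputSize l β u z n ω,
    fun n ω => hC ((hz n).isPath ω) (inputBound_inputSize n ω),
    tendstoInMeasure_zero_of_norm_le_mul C (tendstoInMeasure_inputSize hδ hu hinit) fun n ω => ?_⟩
  rw [mul_left_comm, norm_mul, NNReal.norm_eq]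

theorem isStarStationary_of_shortMemoryBound {B : ℕ → Ω → ℝ}
    (hB : ∀ n ω, ShortMemoryBound l β (fun t => (z n t ω).ofLp) n (B n ω))
    (hB₀ : TendstoInMeasure P (fun (n : ℕ) ω => (√(n : ℝ))⁻¹ * B n ω) atTop (fun _ => 0)) :
    IsStarStationary (fun n t ω => act βᵀ (z n t ω)) P ∧
      IsStarStationary (fun n t ω => z n t ω - z n ((t : ℤ) - 1) ω) P ∧
      IsStarStationary (fun n t ω => min (z n t ω 0) 0) P := by
  obtain ⟨K, hK⟩ := exists_norm_toLp_le (Fin r)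
  obtain ⟨K', hK'⟩ := exists_norm_toLp_le (Fin (d + 1))
  refine ⟨isStarStationary_of_norm_le K hB₀ fun n ω t _ ht => ?_,
    isStarStationary_of_norm_le K' hB₀ fun n ω t _ ht => ?_,
    isStarStationary_of_norm_le 1 hB₀ fun n ω t _ ht => ?_⟩
  · refine (hK _).trans ?_
    gcongr
    exact (hB n ω).eqErr t ht
  · refine (hK' (z n t ω - z n ((t : ℤ) - 1) ω).ofLp).trans ?_
    gcongr
    exact (hB n ω).diff t (by omega) (by omega)
  · rw [NNReal.coe_one, one_mul]
    exact (hB n ω).neg t (by omega) (by omega)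

theorem convergesWeaklyOnD_limitPath [IsProbabilityMeasure P] {Ω' : Type*} [MeasurableSpace Ω']
    {P' : Measure Ω'} [IsProbabilityMeasure P'] {U : I → Ω' → EuclideanSpace ℝ (Fin (d + 1))}
    (hαβ : M.PiMat .pos = α * βᵀ) (hβ : β.rank = r)
    (hαp : IsOrthocomplement α αp) (hβp : IsOrthocomplement β βp) (hκ : M.kappa αp βp 0 < 0)
    (hc : ∃ v, M.PiMat .pos *ᵥ v = M.c) (hz : ∀ n, M.IsGenerated u (z n))
    (hmeas : ∀ n (t : ℕ), AEMeasurable (z n t) P)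
    (hz₀ : TendstoInMeasure P (fun (n : ℕ) ω => (√(n : ℝ))⁻¹ • z n 0 ω) atTop (fun _ => Z₀))
    (hU : ConvergesWeaklyOnD P P'
      (fun (n : ℕ) t ω => (√(n : ℝ))⁻¹ • ∑ i ∈ Finset.Icc 1 ⌊n * (t : ℝ)⌋₊, u i ω) U)
    {B : ℕ → Ω → ℝ} (hB : ∀ n ω, ShortMemoryBound l β (fun t => (z n t ω).ofLp) n (B n ω))
    (hB₀ : TendstoInMeasure P (fun (n : ℕ) ω => (√(n : ℝ))⁻¹ * B n ω) atTop (fun _ => 0)) :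
    ConvergesWeaklyOnD P P'
      (fun (n : ℕ) t ω => (√(n : ℝ))⁻¹ • z n (⌊n * (t : ℝ)⌋₊ : ℕ) ω)
      (M.limitPath αp βp Z₀ U) := by
  obtain ⟨S', U', hS', hU', hconv⟩ := hU
  obtain ⟨C, hC⟩ := exists_norm_sub_limitMap_le hαβ hβ hαp hβp hκ hc Z₀
  let Z' : ℕ → Ω → CadlagSpace (EuclideanSpace ℝ (Fin (d + 1))) := fun n ω =>
    stepFun n fun i => (√(n : ℝ))⁻¹ • z n (i : ℕ) ω
  let err : ℕ → Ω → ℝ := fun n ω => (√(n : ℝ))⁻¹ * B n ω + ‖(√(n : ℝ))⁻¹ • z n 0 ω - Z₀‖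
  have hZ'meas (n : ℕ) : AEMeasurable (Z' n) P :=
    (continuous_stepFun n).measurable.comp_aemeasurable
      (aemeasurable_pi_lambda _ fun i => (hmeas n i).const_smul (√(n : ℝ))⁻¹)
  have herr : TendstoInMeasure P (fun n ω => C * err n ω) atTop (fun _ => 0) := by
    have hinit : TendstoInMeasure P (fun (n : ℕ) ω => ‖(√(n : ℝ))⁻¹ • z n 0 ω - Z₀‖) atTop
        (fun _ => 0) := by
      simpa only [tendstoInMeasure_iff_norm, sub_zero, norm_norm] using hz₀
    have hadd := tendstoInMeasure_add hB₀ hinit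
    rw [add_zero] at hadd
    exact tendstoInMeasure_zero_of_norm_le_mul C hadd fun n ω => by rw [norm_mul, NNReal.norm_eq]
  have hclose (n : ℕ) :
      ∀ᵐ ω ∂P, edist (Z' n ω) (M.limitMap αp βp Z₀ (S' n ω)) ≤ ENNReal.ofReal (C * err n ω) := by
    filter_upwards [hS' n] with ω hω
    have hpath := hC ((hz n).isPath ω) (hB n ω) (by positivity) (S' n ω) hω
    exact (CadlagSpace.edist_le_ofReal_iff ((norm_nonneg _).trans (hpath 0))).2 hpath
  refine ⟨Z', M.limitMap αp βp Z₀ ∘ U', fun n => ae_of_all _ fun ω t => rfl, ?_,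
    tendstoInDistribution_of_tendsto_measure_edist
      (hconv.continuous_comp (M.continuous_limitMap αp βp Z₀)) hZ'meas
      fun ε hε => tendsto_measure_edist_of_ae_edist_le herr hclose hε⟩
  filter_upwards [hU'] with ω hω t
  rw [Function.comp_apply, limitMap_path, funext hω, limitPath_eq_regulatedTrend]

end CKSVAR

end

end RegCoint

theorem theorem1 {d l : ℕ} (M : RegCoint.CKSVAR d l)
    {Ω : Type*} [MeasurableSpace Ω] (P : Measure Ω) [IsProbabilityMeasure P]
    {Ω' : Type*} [MeasurableSpace Ω'] (P' : Measure Ω') [IsProbabilityMeasure P']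
    (u : ℕ → Ω → EuclideanSpace ℝ (Fin (d + 1)))
    (z : ℕ → ℤ → Ω → EuclideanSpace ℝ (Fin (d + 1)))
    (hz : ∀ n, M.IsGenerated u (z n))
    (δ : ℝ) (U : unitInterval → Ω' → EuclideanSpace ℝ (Fin (d + 1)))
    (S : Matrix (Fin (d + 1)) (Fin (d + 1)) ℝ)
    (herr : RegCoint.ErrorCondition P P' u δ U S)
    (q rk : RegCoint.Regime → ℕ) (hroots : M.HasUnitRoots q rk)
    (r : ℕ) (hrpos : rk .pos = r) (hrneg : rk .neg = r + 1) (hrx : M.PiX.rank = r)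
    (α β : Matrix (Fin (d + 1)) (Fin r) ℝ) (hα : α.rank = r) (hβ : β.rank = r)
    (hαβ : M.PiMat .pos = α * βᵀ)
    (hjsr : RegCoint.jointSpectralRadius {M.F α β 0, M.F α β 1} < 1)
    (αp βp : Matrix (Fin (d + 1)) (Fin (q .pos)) ℝ)
    (hαp : RegCoint.IsOrthocomplement α αp) (hβp : RegCoint.IsOrthocomplement β βp)
    (hκ : M.kappa αp βp 0 < 0)
    (Z₀ : EuclideanSpace ℝ (Fin (d + 1)))
    (hinit : RegCoint.InitialCondition M P β δ z Z₀) :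
    (RegCoint.IsStarStationary (fun n t ω => RegCoint.act βᵀ (z n t ω)) P ∧
      RegCoint.IsStarStationary (fun n t ω => z n t ω - z n ((t : ℤ) - 1) ω) P ∧
      RegCoint.IsStarStationary (fun n t ω => min (z n t ω 0) 0) P) ∧
    RegCoint.ConvergesWeaklyOnD P P'
      (fun (n : ℕ) t ω => (√(n : ℝ))⁻¹ • z n (⌊n * (t : ℝ)⌋₊ : ℕ) ω)
      (M.limitPath αp βp Z₀ U) ∧
    (∀ ω t, M.limitPath αp βp Z₀ U t ω 0 =
      M.projU αp βp Z₀ U t ω 0 +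
        RegCoint.regulator (fun s => M.projU αp βp Z₀ U s ω 0) t) ∧
    RegCoint.IsRegulatedBrownianMotion (fun t ω => M.limitPath αp βp Z₀ U t ω 0) (Z₀ 0) P' := by
  have hκ₀ : M.kappa αp βp 0 ≠ 0 := hκ.ne
  have hrank : M.PiX.rank < (M.PiMat .neg).rank := by
    rw [hrx, hroots.rank_eq .neg, hrneg]
    exact Nat.lt_succ_self r
  have hZ₀ : 0 ≤ Z₀ 0 := RegCoint.CKSVAR.commonTrends_zero_nonneg hrank hinit.mem
  have hfix : M.proj αp βp *ᵥ M.GammaOne .pos *ᵥ Z₀.ofLp = Z₀.ofLp :=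
    RegCoint.CKSVAR.proj_mulVec_gammaOne_mulVec hκ₀ hβ hβp
      (RegCoint.CKSVAR.transpose_mulVec_eq_zero_of_mem_commonTrends hαβ hα hZ₀ hinit.mem)
  have hmeas (n t : ℕ) : AEMeasurable (z n t) P :=
    (hz n).aemeasurable (fun t ht => (herr.moments.1 t ht).aemeasurable) (hinit.measurable n) t t
      (by omega) le_rfl
  obtain ⟨B, hB, hB₀⟩ := RegCoint.CKSVAR.exists_shortMemoryBound_tendstoInMeasure hαβ hjsr hz
    herr.delta_pos herr.moments hinit
  exact ⟨RegCoint.CKSVAR.isStarStationary_of_shortMemoryBound hB hB₀,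
    RegCoint.CKSVAR.convergesWeaklyOnD_limitPath hαβ hβ hαp hβp hκ (hroots.intercept .pos) hz
      hmeas hinit.tendsto herr.partialSums hB hB₀,
    fun ω t => RegCoint.CKSVAR.limitPath_zero hκ₀ t ω,
    RegCoint.CKSVAR.isRegulatedBrownianMotion_limitPath_zero herr.brownian herr.posDef hκ₀ hZ₀
      hfix⟩
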